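/- Let $n\ge 3$. Let $\widetilde\Delta$ be a finite disjoint union of oriented Euclidean $n$-simplices, and let $\Phi$ be a family of orientation-reversing affine isomorphisms, closed under inverses, that pairs each facet of $\widetilde\Delta$ with a different facet. Let $\widehat M=\widetilde\Delta/\Phi$ be the quotient space, with quotient map $p$; assume that $\widehat M$ is connected. Let $M$ be the complement in $\widehat M$ of the image of the set of vertices of $\widetilde\Delta$. A $k$-singlex is the image under $p$ of a $k$-simplex of $\widetilde\Delta$, its degree is the number of $k$-simplices of $\widetilde\Delta$ that $p$ maps onto it, and the triangulation is called even if each $(n-2)$-singlex has even degree. The dual graph in $M$ has the barycentres of the $n$-simplices as vertices, and for each pair of facets $\tau,\varphi(\tau)$ identified by $\varphi\in\Phi$ it has an edge, which joins the barycentres of the two incident $n$-simplices by straight segments through the common barycentre of the identified facets. The perspectivity $p_\tau$ across a facet $\tau$ of a simplex $\sigma$, paired by $\varphi$ with a facet $\varphi(\tau)$ of $\sigma'$, is the bijection from the vertices of $\sigma$ to those of $\sigma'$ that equals $\varphi$ on the vertices of $\tau$ and sends the vertex of $\sigma$ opposite to $\tau$ to the vertex of $\sigma'$ opposite to $\varphi(\tau)$.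 Fix an $n$-simplex $\sigma_0$ and let $x_0$ be the image of its barycentre. For an edge loop $\gamma$ at $x_0$ in the dual graph that crosses the facets $\tau_0,\dots,\tau_k$ in this order, the projectivity of $\gamma$ is $p_\gamma=p_{\tau_k}\circ\dots\circ p_{\tau_0}\in\mathrm{Sym}(\sigma_0)\cong\mathrm{Sym}(n+1)$ (the identity for the constant loop). Consider the assignment $$\pi_1(M,x_0)\ni[\gamma]\longmapsto p_\gamma\in\mathrm{Sym}(\sigma_0).\qquad(*)$$ (1) If $(*)$ is a well-defined homomorphism on $\pi_1(M,x_0)$, then the triangulation is even. (2) Conversely, if the triangulation is even, and if $n=3$ or $M$ is a PL $n$-manifold with respect to the triangulation (each point of $M$ has a chart to $\mathbb R^n$ that is piecewise affine on the simplices), then $(*)$ is a well-defined homomorphism. In particular, if $n=3$ or $M$ is a PL $n$-manifold with respect to the triangulation, then $(*)$ is a well-defined homomorphism if and only if the triangulation is even. (The product of $\pi_1(M,x_0)$ is written here in the same order as the composition of permutations: $[\gamma][\delta]$ is the class of $\delta$ followed by $\gamma$.) -/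

import Mathlib

open Topology

/-- Points of the standard Euclidean `n`-simplex, in barycentric coordinates indexed by its
vertices `0, …, n`. -/
abbrev Simplex (n : ℕ) : Type := stdSimplex ℝ (Fin (n + 1))

/-- A facet of the disjoint union of the simplices `σ_t`, `t : T`: the pair `(t, i)` is the
facet of `σ_t` opposite to its corner `i`. -/
abbrev Facet (n : ℕ) (T : Type*) : Type _ := T × Fin (n + 1)

/-- A family of affine isomorphisms pairing the facets of the `n`-simplices `σ_t`, `t : T`.
The facet `f` is paired with the facet `partner f ≠ f`; the affine isomorphism between the two
is given by the bijection `vertexMap f` between their vertices. The family is closed under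
inverses. -/
structure FacePairing (n : ℕ) (T : Type*) where
  partner : Facet n T → Facet n T
  partner_ne : ∀ f, partner f ≠ f
  partner_partner : ∀ f, partner (partner f) = f
  vertexMap : ∀ f : Facet n T, {j : Fin (n + 1) // j ≠ f.2} ≃ {j : Fin (n + 1) // j ≠ (partner f).2}
  vertexMap_vertexMap : ∀ f j, (vertexMap (partner f) (vertexMap f j)).1 = j.1

namespace FacePairing

variable {n : ℕ} {T : Type*} (K : FacePairing n T)

/-- The perspectivity across the facet `f`, as a map on vertices: it is the face pairing on the
vertices of `f`, and sends the corner opposite to `f` to the corner opposite to `partner f`. -/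
def perspFun (f : Facet n T) (j : Fin (n + 1)) : Fin (n + 1) :=
  if h : j ≠ f.2 then (K.vertexMap f ⟨j, h⟩).1 else (K.partner f).2

theorem perspFun_of_ne (f : Facet n T) {j : Fin (n + 1)} (h : j ≠ f.2) :
    K.perspFun f j = (K.vertexMap f ⟨j, h⟩).1 := dif_pos h

theorem perspFun_opposite (f : Facet n T) : K.perspFun f f.2 = (K.partner f).2 :=
  dif_neg (fun h => h rfl)

/-- The perspectivity across the partner facet is the inverse perspectivity. -/
theorem perspFun_perspFun (f : Facet n T) (j : Fin (n + 1)) :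
    K.perspFun (K.partner f) (K.perspFun f j) = j := by
  by_cases h : j = f.2
  · subst h
    rw [perspFun_opposite, perspFun_opposite, K.partner_partner]
  · rw [K.perspFun_of_ne f h, K.perspFun_of_ne (K.partner f) (K.vertexMap f ⟨j, h⟩).2]
    exact K.vertexMap_vertexMap f ⟨j, h⟩

/-- The perspectivity across the facet `f = (t, i)`, a bijection from the vertices of `σ_t` to
the vertices of the simplex on the other side of `f`. -/
def perspectivity (f : Facet n T) : Equiv.Perm (Fin (n + 1)) where
  toFun := K.perspFun f
  invFun := K.perspFun (K.partner f)
  left_inv := K.perspFun_perspFun f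
  right_inv := fun j => by
    have h := K.perspFun_perspFun (K.partner f) j
    rwa [K.partner_partner f] at h

end FacePairing

/-- A (singular) triangulation of an oriented `n`-dimensional pseudo-manifold: oriented
`n`-simplices `σ_t`, `t : T`, with orientation-reversing face pairings. The value
`orientation t` compares the orientation of `σ_t` with the one given by the order of its
vertices. A face pairing reverses the boundary orientations of the facets if and only if the
affine isomorphism of simplices that extends it by sending the opposite corner to the opposite
corner (the perspectivity) reverses the orientations of the simplices. -/
structure Triangulation (n : ℕ) (T : Type*) extends FacePairing n T where
  orientation : T → ℤˣ
  orientation_reversing : ∀ f : Facet n T,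
    Equiv.Perm.sign (toFacePairing.perspectivity f) * orientation f.1 *
      orientation (partner f).1 = -1

namespace Triangulation

variable {n : ℕ} {T : Type*} (K : Triangulation n T)

/-- The disjoint union of the `n`-simplices, with the disjoint union topology. -/
abbrev Points (_K : Triangulation n T) : Type _ := Σ _ : T, Simplex n

/-- `x` lies on some facet, and the face pairing of that facet sends `x` to `y`. -/
def Glued (x y : K.Points) : Prop :=
  ∃ f : Facet n T, x.1 = f.1 ∧ y.1 = (K.partner f).1 ∧ x.2.1 f.2 = 0 ∧
    y.2.1 (K.partner f).2 = 0 ∧ ∀ j, y.2.1 (K.vertexMap f j).1 = x.2.1 j.1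

/-- The pseudo-manifold: the quotient of the disjoint union of the simplices by the equivalence
relation generated by the face pairings, with the quotient topology. -/
def Space : Type _ := Quot K.Glued

instance : TopologicalSpace K.Space := inferInstanceAs (TopologicalSpace (Quot K.Glued))

/-- The quotient map `p`. -/
def proj : K.Points → K.Space := Quot.mk K.Glued

theorem continuous_proj : Continuous K.proj := continuous_quot_mk

/-- The closed simplex of the disjoint union spanned by the vertices of `σ_t` in `F`. -/
def face (t : T) (F : Finset (Fin (n + 1))) : Set K.Points :=
  {x | x.1 = t ∧ ∀ j, j ∉ F → x.2.1 j = 0}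

/-- A `k`-singlex: the image of a `k`-simplex under the quotient map. -/
def IsSinglex (k : ℕ) (S : Set K.Space) : Prop :=
  ∃ (t : T) (F : Finset (Fin (n + 1))), F.card = k + 1 ∧ K.proj '' K.face t F = S

/-- The degree of a `k`-singlex `S`: the number of sheets of `p` over it, that is, the number of
`k`-simplices of the disjoint union that `p` maps onto `S`. -/
noncomputable def degree (k : ℕ) (S : Set K.Space) : ℕ :=
  Nat.card {c : T × Finset (Fin (n + 1)) // c.2.card = k + 1 ∧ K.proj '' K.face c.1 c.2 = S}

/-- The triangulation is even if each `(n-2)`-singlex has even degree. -/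
def IsEven : Prop := ∀ S : Set K.Space, K.IsSinglex (n - 2) S → Even (K.degree (n - 2) S)

/-- The `k`-skeleton of the disjoint union of the simplices. -/
def skeleton (k : ℕ) : Set K.Points :=
  {x | ∃ (t : T) (F : Finset (Fin (n + 1))), F.card = k + 1 ∧ x ∈ K.face t F}

/-- `M`: the complement of the image of the `0`-skeleton. -/
def M : Type _ := {x : K.Space // x ∉ K.proj '' K.skeleton 0}

instance : TopologicalSpace K.M :=
  inferInstanceAs (TopologicalSpace {x : K.Space // x ∉ K.proj '' K.skeleton 0})

theorem mem_skeleton_zero {x : K.Points} :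
    x ∈ K.skeleton 0 ↔ ∃ i, ∀ j, j ≠ i → x.2.1 j = 0 := by
  constructor
  · rintro ⟨t, F, hF, -, h⟩
    obtain ⟨i, rfl⟩ := Finset.card_eq_one.1 hF
    exact ⟨i, fun j hj => h j (by simpa using hj)⟩
  · rintro ⟨i, h⟩
    exact ⟨x.1, {i}, by simp, rfl, fun j hj => h j (by simpa using hj)⟩

theorem Glued.symm {x y : K.Points} (h : K.Glued x y) : K.Glued y x := by
  obtain ⟨f, h1, h2, h3, h4, h5⟩ := h
  refine ⟨K.partner f, h2, ?_, h4, ?_, fun j => ?_⟩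
  · rw [K.partner_partner]; exact h1
  · rw [K.partner_partner]; exact h3
  · obtain ⟨l, rfl⟩ := (K.vertexMap f).surjective j
    rw [K.vertexMap_vertexMap, h5]

theorem Glued.mem_skeleton_zero {x y : K.Points} (h : K.Glued x y) (hx : x ∈ K.skeleton 0) :
    y ∈ K.skeleton 0 := by
  rw [Triangulation.mem_skeleton_zero] at hx ⊢
  obtain ⟨f, -, -, h3, h4, h5⟩ := h
  obtain ⟨i, hi⟩ := hx
  have hif : i ≠ f.2 := by
    rintro rfl
    have hs := x.2.2.2
    rw [Finset.sum_eq_zero] at hs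
    · exact zero_ne_one hs
    · intro j _
      by_cases hj : j = f.2
      · rw [hj]; exact h3
      · exact hi j hj
  refine ⟨(K.vertexMap f ⟨i, hif⟩).1, fun j hj => ?_⟩
  by_cases hjf : j = (K.partner f).2
  · rw [hjf]; exact h4
  · obtain ⟨l, hl⟩ := (K.vertexMap f).surjective ⟨j, hjf⟩
    have hl' : (K.vertexMap f l).1 = j := congrArg Subtype.val hl
    rw [← hl', h5]
    refine hi _ fun hli => hj ?_
    rw [← hl']
    congr 2
    exact Subtype.ext hli

/-- A point of the disjoint union which is not a corner is mapped into `M`. -/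
theorem proj_notMem {x : K.Points} (hx : x ∉ K.skeleton 0) :
    K.proj x ∉ K.proj '' K.skeleton 0 := by
  rintro ⟨y, hy, hyx⟩
  have key : ∀ a b : K.Points, Relation.EqvGen K.Glued a b →
      (a ∈ K.skeleton 0 ↔ b ∈ K.skeleton 0) := by
    intro a b hab
    induction hab with
    | rel a b h => exact ⟨h.mem_skeleton_zero, h.symm.mem_skeleton_zero⟩
    | refl a => exact Iff.rfl
    | symm a b _ ih => exact ih.symm
    | trans a b c _ _ ih1 ih2 => exact ih1.trans ih2
  exact hx ((key y x (Quot.eqvGen_exact hyx)).1 hy)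

/-- The barycentre of the `n`-simplex. -/
noncomputable def barycentre (n : ℕ) : Simplex n :=
  ⟨fun _ => 1 / ((n : ℝ) + 1), fun _ => by positivity, by
    simp only [Finset.sum_const, Finset.card_univ, Fintype.card_fin, nsmul_eq_mul]
    push_cast
    field_simp⟩

/-- The barycentre of the facet of the `n`-simplex opposite to the corner `i`. -/
noncomputable def facetBarycentre (hn : 3 ≤ n) (i : Fin (n + 1)) : Simplex n :=
  ⟨fun j => if j = i then 0 else 1 / (n : ℝ), fun j => by dsimp only; split_ifs <;> positivity, by
    have h0 : (n : ℝ) ≠ 0 := by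
      have : 0 < n := by omega
      positivity
    rw [← Finset.add_sum_erase _ _ (Finset.mem_univ i), if_pos rfl, zero_add,
      Finset.sum_congr rfl (g := fun _ => 1 / (n : ℝ))
        (fun j hj => if_neg (Finset.ne_of_mem_erase hj))]
    simp [Finset.card_erase_of_mem, h0]⟩

/-- The point at time `s` on the straight segment from the barycentre of the `n`-simplex to the
barycentre of its facet opposite to `i`. -/
noncomputable def segmentPoint (hn : 3 ≤ n) (i : Fin (n + 1)) (s : unitInterval) : Simplex n :=
  ⟨(1 - s.1) • (barycentre n).1 + s.1 • (facetBarycentre hn i).1,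
    convex_stdSimplex ℝ _ (barycentre n).2 (facetBarycentre hn i).2
      (by linarith [s.2.2]) s.2.1 (by ring)⟩

theorem continuous_segmentPoint (hn : 3 ≤ n) (i : Fin (n + 1)) :
    Continuous (segmentPoint hn i) := by
  unfold segmentPoint
  refine Continuous.subtype_mk ?_ _
  fun_prop

theorem segmentPoint_zero (hn : 3 ≤ n) (i : Fin (n + 1)) : segmentPoint hn i 0 = barycentre n := by
  apply Subtype.ext
  simp [segmentPoint]

theorem segmentPoint_one (hn : 3 ≤ n) (i : Fin (n + 1)) :
    segmentPoint hn i 1 = facetBarycentre hn i := by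
  apply Subtype.ext
  simp [segmentPoint]

theorem segmentPoint_pos (hn : 3 ≤ n) (i : Fin (n + 1)) (s : unitInterval) {j : Fin (n + 1)}
    (hj : j ≠ i) : 0 < (segmentPoint hn i s).1 j := by
  have h0 : (0 : ℝ) < n := by
    have : 0 < n := by omega
    positivity
  have e : (segmentPoint hn i s).1 j = (1 - s.1) * (1 / ((n : ℝ) + 1)) + s.1 * (1 / (n : ℝ)) := by
    simp [segmentPoint, barycentre, facetBarycentre, hj]
  rw [e]
  have h1 : 0 < 1 / ((n : ℝ) + 1) := by positivity
  have h2 : 0 < 1 / (n : ℝ) := by positivity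
  rcases eq_or_lt_of_le s.2.1 with h | h
  · rw [← h]; simpa using h1
  · have h3 : 0 ≤ (1 - s.1) * (1 / ((n : ℝ) + 1)) := mul_nonneg (by linarith [s.2.2]) h1.le
    have h4 := mul_pos h h2
    linarith

theorem segmentPoint_notMem (hn : 3 ≤ n) (f : Facet n T) (s : unitInterval) :
    (⟨f.1, segmentPoint hn f.2 s⟩ : K.Points) ∉ K.skeleton 0 := by
  rw [mem_skeleton_zero]
  rintro ⟨k, hk⟩
  obtain ⟨j, hj⟩ : ∃ j : Fin (n + 1), j ∉ ({f.2, k} : Finset (Fin (n + 1))) := by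
    by_contra hall
    push Not at hall
    have hc := Finset.card_le_card (fun x _ => hall x : Finset.univ ⊆ _)
    have := Finset.card_le_two (a := f.2) (b := k)
    simp only [Finset.card_univ, Fintype.card_fin] at hc
    omega
  simp only [Finset.mem_insert, Finset.mem_singleton, not_or] at hj
  exact (segmentPoint_pos hn f.2 s hj.1).ne' (hk j hj.2)

/-- The point of `M` at time `s` on the segment from the barycentre of `σ_t` to the barycentre
of its facet `f = (t, i)`. -/
noncomputable def halfEdgePoint (hn : 3 ≤ n) (f : Facet n T) (s : unitInterval) : K.M :=
  ⟨K.proj ⟨f.1, segmentPoint hn f.2 s⟩, K.proj_notMem (K.segmentPoint_notMem hn f s)⟩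

/-- The vertex of the dual graph in the simplex `σ_t`: the image of the barycentre of `σ_t`. -/
noncomputable def dualVertex (hn : 3 ≤ n) (t : T) : K.M :=
  ⟨K.proj ⟨t, barycentre n⟩, by
    have h := (K.halfEdgePoint hn (t, 0) 0).2
    simpa only [halfEdgePoint, segmentPoint_zero] using h⟩

/-- The image in `M` of the barycentre of the facet `f`. -/
noncomputable def facetPoint (hn : 3 ≤ n) (f : Facet n T) : K.M :=
  ⟨K.proj ⟨f.1, facetBarycentre hn f.2⟩, by
    have h := (K.halfEdgePoint hn f 1).2
    simpa only [halfEdgePoint, segmentPoint_one] using h⟩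

theorem facetPoint_partner (hn : 3 ≤ n) (f : Facet n T) :
    K.facetPoint hn (K.partner f) = K.facetPoint hn f := by
  apply Subtype.ext
  refine (Quot.sound ⟨f, rfl, rfl, ?_, ?_, fun j => ?_⟩ : K.proj _ = K.proj _).symm
  · simp [facetBarycentre]
  · simp [facetBarycentre]
  · simp [facetBarycentre, j.2, (K.vertexMap f j).2]

/-- Half of an edge of the dual graph: the image of the straight segment from the barycentre of
`σ_t` to the barycentre of its facet `f = (t, i)`. -/
noncomputable def halfEdge (hn : 3 ≤ n) (f : Facet n T) :
    Path (K.dualVertex hn f.1) (K.facetPoint hn f) where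
  toFun := K.halfEdgePoint hn f
  continuous_toFun := by
    refine Continuous.subtype_mk (K.continuous_proj.comp ?_) _
    exact continuous_sigmaMk.comp (continuous_segmentPoint hn f.2)
  source' := by
    apply Subtype.ext
    simp only [halfEdgePoint, dualVertex, segmentPoint_zero]
  target' := by
    apply Subtype.ext
    simp only [halfEdgePoint, facetPoint, segmentPoint_one]

/-- The edge of the dual graph crossing the facet `f`. -/
noncomputable def dualEdge (hn : 3 ≤ n) (f : Facet n T) :
    Path (K.dualVertex hn f.1) (K.dualVertex hn (K.partner f).1) :=
  (K.halfEdge hn f).trans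
    ((K.halfEdge hn (K.partner f)).symm.cast (K.facetPoint_partner hn f).symm rfl)

/-- Edge paths in the dual graph from the simplex `σ_t` to the simplex `σ_{t'}`, recorded by the
facets that they cross, in order. -/
inductive DualPath : T → T → Type _
  | nil (t : T) : DualPath t t
  | cons (f : Facet n T) {t' : T} (rest : DualPath (K.partner f).1 t') : DualPath f.1 t'

namespace DualPath

variable {K}

/-- The path in `M` that runs along the edges of the dual graph. -/
noncomputable def toPath (hn : 3 ≤ n) :
    {t t' : T} → K.DualPath t t' → Path (K.dualVertex hn t) (K.dualVertex hn t')
  | _, _, .nil t => Path.refl (K.dualVertex hn t)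
  | _, _, .cons f rest => (K.dualEdge hn f).trans (rest.toPath hn)

/-- The projectivity along an edge path: the composite of the perspectivities across the facets
that it crosses, the first facet acting first. -/
def projectivity : {t t' : T} → K.DualPath t t' → Equiv.Perm (Fin (n + 1))
  | _, _, .nil _ => 1
  | _, _, .cons f rest => rest.projectivity * K.perspectivity f

end DualPath

/-- The assignment `[γ] ↦ p_γ`, with `γ` running over the loops at `x₀` in the dual graph, is a
well-defined map on the fundamental group of `M`, and this map is the homomorphism `ρ`. Here
`x₀` is the barycentre of `σ_{t₀}`, and both products are in the order in which the right
factor comes first: `[γ] * [δ]` is the class of `δ` followed by `γ`. -/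
def IsCanonicalRep (hn : 3 ≤ n) (t₀ : T)
    (ρ : FundamentalGroup K.M (K.dualVertex hn t₀) →* Equiv.Perm (Fin (n + 1))) : Prop :=
  ∀ a s, ρ a = s ↔ ∃ γ : K.DualPath t₀ t₀,
    FundamentalGroup.fromPath (Path.Homotopic.Quotient.mk (γ.toPath hn)) = a ∧ γ.projectivity = s

/-- `M` is a PL `n`-manifold with respect to the triangulation: around every point there is a
chart which, on each `n`-simplex, is piecewise affine, that is (being continuous), locally given
at each point by one out of finitely many affine maps. -/
def IsPLManifold : Prop :=
  ∀ x : K.M, ∃ e : OpenPartialHomeomorph K.M (EuclideanSpace ℝ (Fin n)), x ∈ e.source ∧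
    ∀ (t : T) (a : Simplex n), (∃ u ∈ e.source, u.1 = K.proj ⟨t, a⟩) →
      ∃ W ∈ 𝓝 a, ∃ A : Set ((Fin (n + 1) → ℝ) →ᵃ[ℝ] EuclideanSpace ℝ (Fin n)), A.Finite ∧
        ∀ b ∈ W, ∀ u ∈ e.source, u.1 = K.proj ⟨t, b⟩ → ∃ L ∈ A, e u = L b.1

end Triangulation

/-!
Label the simplices by permutations of the vertices and multiply the label by the perspectivity
whenever a facet is crossed. The labelled simplices are glued to a space that folds onto `M̂`, and
an edge path of the dual graph lifts to a path along which the labels are multiplied by its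
projectivity. So the assignment `(*)` is well defined as soon as the folding map is a covering over
`M`, that is, unramified; that all classes of loops are classes of edge loops follows by cutting a
path into pieces close to a point, around which `M` contracts radially.

An interior point of a codimension two face is surrounded by a cycle of simplices whose number is
the degree of the face. The projectivity around it, raised to the degree, fixes or exchanges the
two facets at the face according to the parity of the degree. The loop around the face with this
power is contractible, so `(*)` can only be well defined if the degree is even.

Conversely, let the degrees be even. Then the projectivities of the loops close to a point of a
codimension two face fix the two corners opposite to it, and they are even permutations because
they preserve the orientation. For `n = 3` only two further corners are left, hence they are
trivial. In general this argument (or the fact that a projectivity preserves barycentric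
coordinates) shows that the points where the folding map ramifies have codimension three in every
simplex. In a piecewise affine chart around a point `x` the set of apexes from which some ramified
point is seen on a short copy of the dual graph around `x` has measure zero, by dimension; from any
other apex this copy can be coned off in the complement of the ramified points, so the loops around
`x` have trivial projectivities.
-/

open Equiv (Perm)

namespace FacePairing

variable {n : ℕ} {T : Type*} (K : FacePairing n T)

theorem perspectivity_opposite (f : Facet n T) : K.perspectivity f f.2 = (K.partner f).2 :=
  K.perspFun_opposite f

theorem perspectivity_partner (f : Facet n T) :
    K.perspectivity (K.partner f) = (K.perspectivity f)⁻¹ :=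
  eq_inv_iff_mul_eq_one.2 (Equiv.ext (K.perspFun_perspFun f))

/-- The complete unfolding: the simplices are labelled by permutations of the vertices, and crossing
a facet multiplies the label from the left by the perspectivity across this facet. -/
def unfolding : FacePairing n (T × Perm (Fin (n + 1))) where
  partner f := (((K.partner (f.1.1, f.2)).1, K.perspectivity (f.1.1, f.2) * f.1.2),
    (K.partner (f.1.1, f.2)).2)
  partner_ne f h := K.partner_ne (f.1.1, f.2)
    (Prod.ext (congrArg (fun g => g.1.1) h) (congrArg (fun g => g.2) h))
  partner_partner f := by
    obtain ⟨⟨t, s⟩, i⟩ := f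
    simp only [Prod.mk.eta, K.partner_partner, K.perspectivity_partner, inv_mul_cancel_left]
  vertexMap f := K.vertexMap (f.1.1, f.2)
  vertexMap_vertexMap f := K.vertexMap_vertexMap (f.1.1, f.2)

theorem unfolding_perspectivity (f : Facet n (T × Perm (Fin (n + 1)))) :
    K.unfolding.perspectivity f = K.perspectivity (f.1.1, f.2) :=
  Equiv.ext fun _ => rfl

end FacePairing

namespace Simplex

variable {n : ℕ}

/-- The affine automorphism of the simplex that permutes the vertices by `σ`. -/
def permute (σ : Perm (Fin (n + 1))) (a : Simplex n) : Simplex n :=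
  ⟨fun j => a.1 (σ⁻¹ j), fun _ => a.2.1 _, (Equiv.sum_comp σ⁻¹ a.1).trans a.2.2⟩

@[simp] theorem permute_apply_apply (σ : Perm (Fin (n + 1))) (a : Simplex n) (j : Fin (n + 1)) :
    (permute σ a).1 (σ j) = a.1 j :=
  congrArg a.1 (σ.symm_apply_apply j)

theorem permute_one (a : Simplex n) : permute 1 a = a := rfl

theorem permute_mul (σ τ : Perm (Fin (n + 1))) (a : Simplex n) :
    permute (σ * τ) a = permute σ (permute τ a) := by
  refine Subtype.ext (funext fun j => ?_)
  simp only [permute, mul_inv_rev, Perm.mul_apply]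

theorem dist_permute_le (σ : Perm (Fin (n + 1))) (a b : Simplex n) :
    dist (permute σ a) (permute σ b) ≤ dist a b :=
  (dist_pi_le_iff dist_nonneg).2 fun j => dist_le_pi_dist a.1 b.1 (σ⁻¹ j)

end Simplex

namespace Triangulation

open Simplex

variable {n : ℕ} {T : Type*} (K : Triangulation n T) {t t' : T} {s s' : Perm (Fin (n + 1))}
  {a a' : Simplex n} {i : Fin (n + 1)}

/-- The triangulation by the simplices of the complete unfolding, each with the orientation of the
simplex that it covers. -/
def unfolding : Triangulation n (T × Perm (Fin (n + 1))) where
  __ := K.toFacePairing.unfolding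
  orientation t := K.orientation t.1
  orientation_reversing f := by
    rw [FacePairing.unfolding_perspectivity]
    exact K.orientation_reversing (f.1.1, f.2)

theorem unfolding_perspectivity (f : Facet n (T × Perm (Fin (n + 1)))) :
    K.unfolding.perspectivity f = K.perspectivity (f.1.1, f.2) :=
  K.toFacePairing.unfolding_perspectivity f

theorem glued_iff {x y : K.Points} : K.Glued x y ↔ ∃ i, x.2.1 i = 0 ∧
    y = ⟨(K.partner (x.1, i)).1, permute (K.perspectivity (x.1, i)) x.2⟩ := by
  constructor
  · rintro ⟨⟨t, i⟩, h1, h2, hx, hy, hxy⟩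
    obtain ⟨t', a⟩ := x
    obtain ⟨t'', b⟩ := y
    dsimp only at h1 h2 hx hy hxy
    subst h1 h2
    refine ⟨i, hx, congrArg (Sigma.mk _) (Subtype.ext (funext fun j => ?_))⟩
    obtain ⟨j, rfl⟩ := (K.perspectivity (t', i)).surjective j
    rw [permute_apply_apply]
    by_cases hj : j = i
    · rw [hj, hx, ← hy]
      exact congrArg b.1 (K.perspectivity_opposite (t', i))
    · rw [← hxy ⟨j, hj⟩]
      exact congrArg b.1 (K.perspFun_of_ne (t', i) hj)
  · rintro ⟨i, hi, rfl⟩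
    refine ⟨(x.1, i), rfl, rfl, hi, ?_, fun j => ?_⟩
    · rw [← K.perspectivity_opposite (x.1, i), permute_apply_apply, hi]
    · have : (K.vertexMap (x.1, i) j).1 = K.perspectivity (x.1, i) j.1 :=
        (K.perspFun_of_ne (x.1, i) j.2).symm
      rw [this, permute_apply_apply]

theorem proj_cross (t : T) (a : Simplex n) (hi : a.1 i = 0) :
    K.proj ⟨(K.partner (t, i)).1, permute (K.perspectivity (t, i)) a⟩ = K.proj ⟨t, a⟩ :=
  (Quot.sound ((K.glued_iff (x := ⟨t, a⟩)).2 ⟨i, hi, rfl⟩)).symm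

@[elab_as_elim]
theorem proj_eq_induction {x : K.Points} {p : K.Points → Prop} (hx : p x)
    (cross : ∀ y i, p y → y.2.1 i = 0 →
      p ⟨(K.partner (y.1, i)).1, permute (K.perspectivity (y.1, i)) y.2⟩)
    {y : K.Points} (hxy : K.proj x = K.proj y) : p y := by
  have : Std.Symm K.Glued := ⟨fun _ _ h => h.symm⟩
  have hxy' : Relation.ReflTransGen K.Glued x y :=
    Relation.EqvGen.eqvGen_eq_reflTransGen (r := K.Glued) ▸ Quot.eqvGen_exact hxy
  clear hxy
  induction hxy' with
  | refl => exact hx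
  | tail _ hg ih =>
    obtain ⟨i, hi, rfl⟩ := K.glued_iff.1 hg
    exact cross _ i ih hi

/-- The image in the complete unfolding of the point `a` of the simplex `σ_t` labelled by `s`. -/
def sheet (t : T) (s : Perm (Fin (n + 1))) (a : Simplex n) : K.unfolding.Space :=
  K.unfolding.proj ⟨(t, s), a⟩

theorem sheet_cross (t : T) (s : Perm (Fin (n + 1))) (a : Simplex n) (hi : a.1 i = 0) :
    K.sheet (K.partner (t, i)).1 (K.perspectivity (t, i) * s) (permute (K.perspectivity (t, i)) a) =
      K.sheet t s a := by
  have h := K.unfolding.proj_cross (t, s) a hi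
  rwa [unfolding_perspectivity] at h

theorem sheet_surjective (x : K.unfolding.Space) : ∃ t s a, K.sheet t s a = x := by
  obtain ⟨⟨⟨t, s⟩, a⟩, rfl⟩ := Quot.exists_rep x
  exact ⟨t, s, a, rfl⟩

@[elab_as_elim]
theorem sheet_eq_induction {p : T → Perm (Fin (n + 1)) → Simplex n → Prop} (base : p t s a)
    (cross : ∀ t s a i, p t s a → a.1 i = 0 → p (K.partner (t, i)).1
      (K.perspectivity (t, i) * s) (permute (K.perspectivity (t, i)) a))
    (h : K.sheet t s a = K.sheet t' s' a') : p t' s' a' :=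
  K.unfolding.proj_eq_induction (p := fun y => p y.1.1 y.1.2 y.2) base (fun y i hy hi => by
    rw [unfolding_perspectivity]
    exact cross y.1.1 y.1.2 y.2 i hy hi) h

theorem eq_permute_of_sheet_eq (h : K.sheet t s a = K.sheet t' s' a') :
    a' = permute (s' * s⁻¹) a :=
  K.sheet_eq_induction (p := fun _ s' a' => a' = permute (s' * s⁻¹) a)
    (by rw [mul_inv_cancel, permute_one])
    (fun _ _ _ _ ha' _ => by rw [mul_assoc, permute_mul, ← ha']) h

theorem sheet_mul_right (h : K.sheet t s a = K.sheet t' s' a') (g : Perm (Fin (n + 1))) :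
    K.sheet t (s * g) a = K.sheet t' (s' * g) a' :=
  K.sheet_eq_induction (p := fun t' s' a' => K.sheet t (s * g) a = K.sheet t' (s' * g) a') rfl
    (fun _ _ _ _ h hi => by rw [h, mul_assoc, K.sheet_cross _ _ _ hi]) h

theorem exists_sheet_eq (h : K.proj ⟨t, a⟩ = K.proj ⟨t', a'⟩) (s : Perm (Fin (n + 1))) :
    ∃ s', K.sheet t s a = K.sheet t' s' a' :=
  K.proj_eq_induction (p := fun y => ∃ s', K.sheet t s a = K.sheet y.1 s' y.2) ⟨s, rfl⟩
    (fun y i ⟨s', hs'⟩ hi => ⟨K.perspectivity (y.1, i) * s',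
      hs'.trans (K.sheet_cross y.1 s' y.2 hi).symm⟩) h

theorem exists_eq_permute (h : K.proj ⟨t, a⟩ = K.proj ⟨t', a'⟩) : ∃ σ, a' = permute σ a :=
  let ⟨_, hs⟩ := K.exists_sheet_eq h 1
  ⟨_, K.eq_permute_of_sheet_eq hs⟩

/-- The folding map from the complete unfolding, which forgets the labels. -/
def fold : K.unfolding.Space → K.Space :=
  Quot.lift (fun x => K.proj ⟨x.1.1, x.2⟩) fun x y h => by
    obtain ⟨i, hi, rfl⟩ := K.unfolding.glued_iff.1 h
    rw [unfolding_perspectivity]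
    exact (K.proj_cross x.1.1 x.2 hi).symm

theorem continuous_fold : Continuous K.fold :=
  continuous_quot_lift _ (K.continuous_proj.comp (continuous_sigma fun t =>
    continuous_sigmaMk (σ := fun _ : T => Simplex n) (i := t.1)))

theorem fold_surjective : Function.Surjective K.fold := by
  intro x
  obtain ⟨⟨t, a⟩, rfl⟩ := Quot.exists_rep x
  exact ⟨K.sheet t 1 a, rfl⟩

theorem isOpenMap_fold : IsOpenMap K.fold := by
  intro U hU
  have quotientMap : IsQuotientMap K.proj := isQuotientMap_quot_mk
  rw [← quotientMap.isOpen_preimage, isOpen_sigma_iff]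
  intro t
  have preimage_eq : Sigma.mk t ⁻¹' (K.proj ⁻¹' (K.fold '' U)) = ⋃ s, K.sheet t s ⁻¹' U := by
    ext a
    rw [Set.mem_iUnion]
    constructor
    · rintro ⟨y, hy, hya⟩
      obtain ⟨t', s, a', rfl⟩ := K.sheet_surjective y
      obtain ⟨s', hs'⟩ := K.exists_sheet_eq hya s
      exact ⟨s', (hs' ▸ hy : K.sheet t s' a ∈ U)⟩
    · rintro ⟨s, hs⟩
      exact ⟨_, hs, rfl⟩
  rw [preimage_eq]
  exact isOpen_iUnion fun s => hU.preimage (K.unfolding.continuous_proj.comp continuous_sigmaMk)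

instance : MulAction (Perm (Fin (n + 1))) K.unfolding.Space where
  smul g := Quot.lift (fun x => K.sheet x.1.1 (x.1.2 * g⁻¹) x.2) fun _ _ h =>
    K.sheet_mul_right (Quot.sound h) g⁻¹
  one_smul x := by
    obtain ⟨t, s, a, rfl⟩ := K.sheet_surjective x
    exact congrArg (K.sheet t · a) (mul_one s)
  mul_smul g g' x := by
    obtain ⟨t, s, a, rfl⟩ := K.sheet_surjective x
    exact congrArg (K.sheet t · a) (by rw [mul_inv_rev, mul_assoc])

theorem smul_sheet (g : Perm (Fin (n + 1))) (t : T) (s : Perm (Fin (n + 1))) (a : Simplex n) :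
    g • K.sheet t s a = K.sheet t (s * g⁻¹) a := rfl

instance : ContinuousConstSMul (Perm (Fin (n + 1))) K.unfolding.Space where
  continuous_const_smul g :=
    continuous_quot_lift _ (K.unfolding.continuous_proj.comp (continuous_sigma fun t =>
      continuous_sigmaMk (σ := fun _ : T × Perm (Fin (n + 1)) => Simplex n)
        (i := (t.1, t.2 * g⁻¹))))

theorem fold_eq_fold_iff {x y : K.unfolding.Space} :
    K.fold x = K.fold y ↔ x ∈ MulAction.orbit (Perm (Fin (n + 1))) y := by
  obtain ⟨t, s, a, rfl⟩ := K.sheet_surjective x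
  obtain ⟨t', s', a', rfl⟩ := K.sheet_surjective y
  constructor
  · intro h
    obtain ⟨u, hu⟩ := K.exists_sheet_eq h s
    refine ⟨u⁻¹ * s', ?_⟩
    change (u⁻¹ * s') • K.sheet t' s' a' = K.sheet t s a
    rw [smul_sheet, mul_inv_rev, inv_inv, mul_inv_cancel_left, hu]
  · rintro ⟨g, hg⟩
    exact (congrArg K.fold hg).symm

/-- The complete unfolding does not ramify over `x`: a point over `x` has at most one label in every
simplex. -/
def IsUnramifiedAt (x : K.Space) : Prop :=
  ∀ t a s s', K.proj ⟨t, a⟩ = x → K.sheet t s a = K.sheet t s' a → s = s'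

theorem isUnramifiedAt_proj (h : ∀ s s', K.sheet t s a = K.sheet t s' a → s = s') :
    K.IsUnramifiedAt (K.proj ⟨t, a⟩) := by
  intro t' a' s s' ht hs
  obtain ⟨u, hu⟩ := K.exists_sheet_eq ht s
  have hu' := K.sheet_mul_right hu (s⁻¹ * s')
  rw [mul_inv_cancel_left, ← hs, hu] at hu'
  have := h _ _ hu'
  rwa [left_eq_mul, inv_mul_eq_one] at this

end Triangulation

namespace Triangulation

open Simplex

variable {n : ℕ} {T : Type*} (K : Triangulation n T) {x : K.Space} {ε : ℝ}

/-- The points of the disjoint union at distance less than `ε` from a point over `x` in the same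
simplex. Distances are measured by the maximum of the differences of the barycentric coordinates,
so the face pairings preserve them. -/
def near (x : K.Space) (ε : ℝ) : Set K.Points :=
  {b | ∃ a, K.proj ⟨b.1, a⟩ = x ∧ dist b.2 a < ε}

/-- The radius `ε` is so small that the neighbourhood `near x ε` is a disjoint union of balls that
meet only those facets on which their centre lies. -/
structure IsSmallRadius (x : K.Space) (ε : ℝ) : Prop where
  pos : 0 < ε
  eq_zero_of_lt : ∀ {t a j}, K.proj ⟨t, a⟩ = x → a.1 j < ε → a.1 j = 0
  eq_of_dist_lt : ∀ {t t' a a'}, K.proj ⟨t, a⟩ = x → K.proj ⟨t', a'⟩ = x → dist a a' < 2 * ε →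
    a = a'

theorem exists_isSmallRadius (x : K.Space) : ∃ ε, K.IsSmallRadius x ε := by
  obtain ⟨⟨t, a⟩, rfl⟩ := Quot.exists_rep x
  let V : Set ℝ := {0, 1} ∪ Set.range a.1
  have V_finite : V.Finite := (Set.toFinite _).union (Set.finite_range _)
  have V_nontrivial : V.Nontrivial := ⟨0, by simp [V], 1, by simp [V], zero_ne_one⟩
  have coord_mem : ∀ {t' a'} (j : Fin (n + 1)), K.proj ⟨t', a'⟩ = K.proj ⟨t, a⟩ → a'.1 j ∈ V := by
    intro t' a' j h
    obtain ⟨σ, rfl⟩ := K.exists_eq_permute h.symm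
    exact Or.inr ⟨_, rfl⟩
  have eq_of_lt : ∀ v ∈ V, ∀ w ∈ V, dist v w < V.infsep → v = w := fun v hv w hw h => by
    by_contra hvw
    exact h.not_ge (Set.infsep_le_dist_of_mem hv hw hvw)
  have infsep_pos : 0 < V.infsep := V_finite.infsep_pos_iff_nontrivial.2 V_nontrivial
  refine ⟨V.infsep / 2, half_pos infsep_pos, fun {t' a' j} h hj => ?_,
    fun {t₁ t₂ a₁ a₂} h₁ h₂ hd => Subtype.ext (funext fun j => ?_)⟩
  · refine eq_of_lt _ (coord_mem j h) 0 (by simp [V]) ?_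
    rw [Real.dist_eq, sub_zero, abs_of_nonneg (a'.2.1 j)]
    linarith
  · refine eq_of_lt _ (coord_mem j h₁) _ (coord_mem j h₂) ?_
    rw [mul_div_cancel₀ _ two_ne_zero] at hd
    exact (dist_le_pi_dist a₁.1 a₂.1 j).trans_lt hd

theorem isOpen_near (x : K.Space) (ε : ℝ) : IsOpen (K.near x ε) := by
  rw [isOpen_sigma_iff]
  intro t
  have preimage_eq : Sigma.mk t ⁻¹' K.near x ε =
      ⋃ (a) (_ : K.proj ⟨t, a⟩ = x), Metric.ball a ε := by
    ext b
    simp [near]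
  rw [preimage_eq]
  exact isOpen_biUnion fun a _ => Metric.isOpen_ball

namespace IsSmallRadius

variable {K} {t : T} {a a' b : Simplex n} (h : K.IsSmallRadius x ε)
include h

theorem mem_near (ha : K.proj ⟨t, a⟩ = x) : ⟨t, a⟩ ∈ K.near x ε :=
  ⟨a, ha, by rw [dist_self]; exact h.pos⟩

theorem eq_of_near (ha : K.proj ⟨t, a⟩ = x) (ha' : K.proj ⟨t, a'⟩ = x) (hb : dist b a < ε)
    (hb' : dist b a' < ε) : a = a' :=
  h.eq_of_dist_lt ha ha' (by linarith [dist_triangle_left a a' b])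

theorem eq_zero_of_near (ha : K.proj ⟨t, a⟩ = x) (hb : dist b a < ε) {j : Fin (n + 1)}
    (hj : b.1 j = 0) : a.1 j = 0 := by
  refine h.eq_zero_of_lt ha ?_
  have hj' := (dist_le_pi_dist b.1 a.1 j).trans_lt hb
  rw [hj, Real.dist_eq, zero_sub, abs_neg] at hj'
  exact (le_abs_self _).trans_lt hj'

theorem mem_near_of_proj_eq {b b' : K.Points} (hb : b ∈ K.near x ε) (hbb : K.proj b = K.proj b') :
    b' ∈ K.near x ε := by
  refine K.proj_eq_induction hb ?_ hbb
  rintro ⟨t, b⟩ i ⟨a, ha, hab⟩ hi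
  refine ⟨permute (K.perspectivity (t, i)) a, ?_, (dist_permute_le _ _ _).trans_lt hab⟩
  rw [← ha]
  exact K.proj_cross t a (h.eq_zero_of_near ha hab hi)

theorem preimage_image_near : K.proj ⁻¹' (K.proj '' K.near x ε) = K.near x ε :=
  Set.Subset.antisymm (fun _ ⟨_, hb, hbb⟩ => h.mem_near_of_proj_eq hb hbb)
    (Set.subset_preimage_image _ _)

theorem isOpen_image_near : IsOpen (K.proj '' K.near x ε) := by
  have quotientMap : IsQuotientMap K.proj := isQuotientMap_quot_mk
  rw [← quotientMap.isOpen_preimage, h.preimage_image_near]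
  exact K.isOpen_near x ε

end IsSmallRadius

/-- The part of the complete unfolding over the points where it does not ramify, as an invariant
subset for the action on the labels. -/
def unramifiedLocus : SubMulAction (Perm (Fin (n + 1))) K.unfolding.Space where
  carrier := {x | K.IsUnramifiedAt (K.fold x)}
  smul_mem' g x hx := by
    have : K.fold (g • x) = K.fold x := K.fold_eq_fold_iff.2 ⟨g, rfl⟩
    rwa [Set.mem_ofPred_eq, this]

/-- The folding map over the points where it does not ramify. -/
def unramifiedFold : K.unramifiedLocus → {x : K.Space // K.IsUnramifiedAt x} :=
  Set.restrictPreimage {x | K.IsUnramifiedAt x} K.fold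

theorem eq_one_of_smul_mem_near {x : K.unfolding.Space} (hx : K.IsUnramifiedAt (K.fold x))
    (hε : K.unfolding.IsSmallRadius x ε) {y : K.unfolding.Space}
    (hy : y ∈ K.unfolding.proj '' K.unfolding.near x ε) {g : Perm (Fin (n + 1))}
    (hgy : g • y ∈ K.unfolding.proj '' K.unfolding.near x ε) : g = 1 := by
  obtain ⟨⟨⟨t, s⟩, b⟩, ⟨a, ha, hab⟩, rfl⟩ := hy
  obtain ⟨a', ha', hab'⟩ : (⟨(t, s * g⁻¹), b⟩ : K.unfolding.Points) ∈ K.unfolding.near x ε := by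
    rw [← hε.preimage_image_near]
    exact hgy
  obtain rfl : a = a' := hε.eq_of_dist_lt ha ha' (by linarith [dist_triangle_left a a' b])
  have := hx t a s (s * g⁻¹) (congrArg K.fold ha) (ha.trans ha'.symm)
  rwa [left_eq_mul, inv_eq_one] at this

theorem isQuotientCoveringMap_unramifiedFold :
    IsQuotientCoveringMap K.unramifiedFold (Perm (Fin (n + 1))) where
  toIsQuotientMap := (K.isOpenMap_fold.restrictPreimage _).isQuotientMap
    K.continuous_fold.restrictPreimage (Set.restrictPreimage_surjective _ K.fold_surjective)
  continuous_const_smul g := (continuous_subtype_val.const_smul g).subtype_mk _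
  apply_eq_iff_mem_orbit {x y} :=
    Subtype.ext_iff.trans (K.fold_eq_fold_iff.trans SubMulAction.mem_orbit_subMul_iff.symm)
  disjoint := by
    rintro ⟨x, hx⟩
    obtain ⟨ε, hε⟩ := K.unfolding.exists_isSmallRadius x
    refine ⟨Subtype.val ⁻¹' (K.unfolding.proj '' K.unfolding.near x ε), ?_, ?_⟩
    · obtain ⟨⟨t, a⟩, rfl⟩ := Quot.exists_rep x
      exact (hε.isOpen_image_near.preimage continuous_subtype_val).mem_nhds
        ⟨⟨t, a⟩, hε.mem_near rfl, rfl⟩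
    · rintro g ⟨-, ⟨y, hy, rfl⟩, hgy⟩
      exact K.eq_one_of_smul_mem_near hx hε hy hgy

theorem eq_of_homotopic_fold {Y : Type*} [TopologicalSpace Y] (j : C(Y, K.Space))
    (hj : ∀ y, K.IsUnramifiedAt (j y)) {y z : Y} {γ δ : Path y z} (h : γ.Homotopic δ)
    {u v w : K.unfolding.Space} (Γ : Path u v) (Δ : Path u w) (hΓ : ∀ τ, K.fold (Γ τ) = j (γ τ))
    (hΔ : ∀ τ, K.fold (Δ τ) = j (δ τ)) : v = w := by
  have covering := K.isQuotientCoveringMap_unramifiedFold.isCoveringMap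
  let j' : C(Y, {x : K.Space // K.IsUnramifiedAt x}) := ⟨fun y => ⟨j y, hj y⟩, by fun_prop⟩
  let Γ' : C(unitInterval, K.unramifiedLocus) :=
    ⟨fun τ => ⟨Γ τ, by change K.IsUnramifiedAt _; rw [hΓ]; exact hj _⟩, by fun_prop⟩
  let Δ' : C(unitInterval, K.unramifiedLocus) :=
    ⟨fun τ => ⟨Δ τ, by change K.IsUnramifiedAt _; rw [hΔ]; exact hj _⟩, by fun_prop⟩
  have same_start : Γ' 0 = Δ' 0 := Subtype.ext (Γ.source.trans Δ.source.symm)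
  have lifts_γ : ∀ τ, γ.map j'.continuous τ = K.unramifiedFold (Γ' τ) := fun τ =>
    Subtype.ext (hΓ τ).symm
  have lifts_δ : ∀ τ, δ.map j'.continuous τ = K.unramifiedFold (Δ' τ) := fun τ =>
    Subtype.ext (hΔ τ).symm
  have same_end := covering.liftPath_apply_one_eq_of_homotopicRel (h.map j') (Γ' 0) (lifts_γ 0)
    (by rw [same_start]; exact lifts_δ 0)
  rw [← (covering.eq_liftPath_iff' (Γ := Γ') _).2 ⟨funext fun τ => (lifts_γ τ).symm, rfl⟩,
    ← (covering.eq_liftPath_iff' (Γ := Δ') _).2 ⟨funext fun τ => (lifts_δ τ).symm,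
      same_start.symm⟩] at same_end
  exact Γ.target.symm.trans ((congrArg Subtype.val same_end).trans Δ.target)

end Triangulation

theorem contractibleSpace_of_contraction {X : Type*} [TopologicalSpace X]
    (G : C(X × unitInterval, X)) (x₀ : X) (h_zero : ∀ x, G (x, 0) = x)
    (h_one : ∀ x, G (x, 1) = x₀) : ContractibleSpace X :=
  (contractible_iff_id_nullhomotopic X).2
    ⟨x₀, ⟨⟨G.comp ContinuousMap.prodSwap, h_zero, h_one⟩⟩⟩

namespace Simplex

variable {n : ℕ}

/-- The straight path from `b` to `a` in the simplex. -/
def segment (b a : Simplex n) : Path b a where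
  toFun τ := ⟨(1 - τ.1) • b.1 + τ.1 • a.1,
    convex_stdSimplex ℝ _ b.2 a.2 (by linarith [τ.2.2]) τ.2.1 (by ring)⟩
  continuous_toFun := by fun_prop
  source' := Subtype.ext (by simp)
  target' := Subtype.ext (by simp)

theorem continuous_segment :
    Continuous fun p : (Simplex n × Simplex n) × unitInterval => segment p.1.1 p.1.2 p.2 := by
  refine Continuous.subtype_mk ?_ _
  have : Continuous (Subtype.val : Simplex n → _) := continuous_subtype_val
  fun_prop

theorem permute_segment (σ : Perm (Fin (n + 1))) (b a : Simplex n) (τ : unitInterval) :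
    permute σ (segment b a τ) = segment (permute σ b) (permute σ a) τ := rfl

theorem segment_eq_zero {a b : Simplex n} {i : Fin (n + 1)} (hb : b.1 i = 0) (ha : a.1 i = 0)
    (τ : unitInterval) : (segment b a τ).1 i = 0 := by
  change (1 - τ.1) * b.1 i + τ.1 * a.1 i = 0
  rw [hb, ha, mul_zero, mul_zero, add_zero]

theorem dist_segment_lt {a b : Simplex n} {ε : ℝ} (h : dist b a < ε) (τ : unitInterval) :
    dist (segment b a τ) a < ε :=
  convex_ball a.1 ε h (Metric.mem_ball_self (dist_nonneg.trans_lt h)) (by linarith [τ.2.2]) τ.2.1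
    (by ring)

/-- The simplex without its vertices. -/
def punctured (n : ℕ) : Set (Simplex n) := {a | ∀ i, a.1 i < 1}

theorem barycentre_mem_punctured (hn : 1 ≤ n) : Triangulation.barycentre n ∈ punctured n := by
  intro i
  have : (1 : ℝ) ≤ n := by exact_mod_cast hn
  change 1 / ((n : ℝ) + 1) < 1
  rw [div_lt_one (by positivity)]
  linarith

theorem facetBarycentre_mem_punctured (hn : 3 ≤ n) (i : Fin (n + 1)) :
    Triangulation.facetBarycentre hn i ∈ punctured n := by
  intro j
  have : (3 : ℝ) ≤ n := by exact_mod_cast hn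
  change (if j = i then 0 else 1 / (n : ℝ)) < 1
  split_ifs
  · exact one_pos
  · rw [div_lt_one (by positivity)]
    linarith

theorem permute_facetBarycentre (hn : 3 ≤ n) (σ : Perm (Fin (n + 1))) (i : Fin (n + 1)) :
    permute σ (Triangulation.facetBarycentre hn i) = Triangulation.facetBarycentre hn (σ i) := by
  refine Subtype.ext (funext fun j => ?_)
  change (if σ⁻¹ j = i then (0 : ℝ) else _) = if j = σ i then 0 else _
  simp only [Perm.inv_eq_iff_eq]

theorem facetBarycentre_self (hn : 3 ≤ n) (i : Fin (n + 1)) :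
    (Triangulation.facetBarycentre hn i).1 i = 0 :=
  if_pos rfl

namespace punctured

theorem segment_mem {a b : Simplex n} (hb : b ∈ punctured n) (ha : a ∈ punctured n)
    (τ : unitInterval) : Simplex.segment b a τ ∈ punctured n := fun i =>
  (convex_Iio (1 : ℝ)) (hb i) (ha i) (by linarith [τ.2.2]) τ.2.1 (by ring)

/-- The straight path from `u` to `v` in the simplex without its vertices. -/
def segment (u v : punctured n) : Path u v where
  toFun τ := ⟨Simplex.segment u.1 v.1 τ, segment_mem u.2 v.2 τ⟩
  continuous_toFun := by fun_prop
  source' := Subtype.ext (Path.source _)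
  target' := Subtype.ext (Path.target _)

theorem contractibleSpace (u : punctured n) : ContractibleSpace (punctured n) :=
  contractibleSpace_of_contraction
    ⟨fun p => segment p.1 u p.2, (continuous_segment.comp (by fun_prop :
      Continuous fun p : punctured n × unitInterval => ((p.1.1, u.1), p.2))).subtype_mk _⟩ u
    (fun v => (segment v u).source) fun v => (segment v u).target

/-- The automorphism of the simplex without its vertices that permutes the vertices by `σ`. -/
def permute (σ : Perm (Fin (n + 1))) (u : punctured n) : punctured n :=
  ⟨Simplex.permute σ u.1, fun _ => u.2 _⟩

/-- The barycentre of the simplex, as a point of the simplex without its vertices. -/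
noncomputable def barycentre (hn : 1 ≤ n) : punctured n := ⟨_, barycentre_mem_punctured hn⟩

/-- The barycentre of a facet, as a point of the simplex without its vertices. -/
noncomputable def facetBarycentre (hn : 3 ≤ n) (i : Fin (n + 1)) : punctured n :=
  ⟨_, facetBarycentre_mem_punctured hn i⟩

end punctured

end Simplex

namespace Triangulation

open Simplex

variable {n : ℕ} {T : Type*} (K : Triangulation n T)

theorem notMem_skeleton_zero_iff {x : K.Points} : x ∉ K.skeleton 0 ↔ x.2 ∈ punctured n := by
  rw [mem_skeleton_zero]
  push Not
  refine forall_congr' fun i => ?_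
  have sum_eq := x.2.2.2
  rw [← Finset.add_sum_erase _ _ (Finset.mem_univ i)] at sum_eq
  constructor
  · rintro ⟨j, hj, hx⟩
    have hj_pos : 0 < x.2.1 j := lt_of_le_of_ne (x.2.2.1 j) hx.symm
    have := Finset.single_le_sum (f := x.2.1) (fun k _ => x.2.2.1 k)
      (Finset.mem_erase.2 ⟨hj, Finset.mem_univ j⟩)
    linarith
  · intro h
    by_contra! hall
    rw [Finset.sum_eq_zero fun j hj => hall j (Finset.ne_of_mem_erase hj)] at sum_eq
    linarith

/-- The quotient map on the simplex `σ_t` without its vertices. -/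
def toM (t : T) : C(punctured n, K.M) where
  toFun u := ⟨K.proj ⟨t, u.1⟩, K.proj_notMem (K.notMem_skeleton_zero_iff.2 u.2)⟩
  continuous_toFun :=
    (K.continuous_proj.comp (continuous_sigmaMk.comp continuous_subtype_val)).subtype_mk _

theorem exists_toM_eq (y : K.M) : ∃ t u, K.toM t u = y := by
  obtain ⟨x, hx⟩ := y
  obtain ⟨⟨t, a⟩, rfl⟩ := Quot.exists_rep x
  exact ⟨t, ⟨a, K.notMem_skeleton_zero_iff.1 fun h => hx ⟨_, h, rfl⟩⟩, rfl⟩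

theorem toM_cross (t : T) (u : punctured n) {i : Fin (n + 1)} (hi : u.1.1 i = 0) :
    K.toM (K.partner (t, i)).1 (punctured.permute (K.perspectivity (t, i)) u) = K.toM t u :=
  Subtype.ext (K.proj_cross t u.1 hi)

section segmentClass

variable {K} {t : T} {u v w : punctured n} {x y z : K.M}

/-- The class of the images of the paths from `u` to `v` in the simplex `σ_t` without its
vertices, as paths between given images `y` of `u` and `z` of `v`. -/
def segmentClass (hu : K.toM t u = y) (hv : K.toM t v = z) : Path.Homotopic.Quotient y z :=
  .mk (((punctured.segment u v).map (K.toM t).continuous).cast hu.symm hv.symm)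

theorem mk_eq_segmentClass (hu : K.toM t u = y) (hv : K.toM t v = z) (p : Path u v) (α : Path y z)
    (hα : ∀ τ, α τ = K.toM t (p τ)) : .mk α = segmentClass hu hv := by
  subst hu hv
  obtain rfl : α = p.map (K.toM t).continuous := Path.ext (funext hα)
  have := punctured.contractibleSpace u
  exact Path.Homotopic.Quotient.eq.2 ((SimplyConnectedSpace.paths_homotopic p _).map (K.toM t))

theorem segmentClass_trans (hu : K.toM t u = x) (hv : K.toM t v = y) (hw : K.toM t w = z) :
    (segmentClass hu hv).trans (segmentClass hv hw) = segmentClass hu hw := by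
  subst hu hv hw
  refine mk_eq_segmentClass rfl rfl ((punctured.segment u v).trans (punctured.segment v w)) _ ?_
  exact fun τ => (DFunLike.congr_fun (Path.map_trans _ _ (K.toM t).continuous) τ).symm

theorem segmentClass_self (hu : K.toM t u = y) : segmentClass hu hu = .refl y := by
  subst hu
  exact (mk_eq_segmentClass rfl rfl (Path.refl u) (Path.refl _) fun _ => rfl).symm

theorem segmentClass_symm (hu : K.toM t u = y) (hv : K.toM t v = z) :
    (segmentClass hu hv).symm = segmentClass hv hu :=
  mk_eq_segmentClass hv hu (punctured.segment u v).symm _ fun _ => rfl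

theorem segmentClass_cross {i : Fin (n + 1)} (hui : u.1.1 i = 0) (hvi : v.1.1 i = 0)
    (hu : K.toM t u = y) (hv : K.toM t v = z) :
    segmentClass hu hv = segmentClass ((K.toM_cross t u hui).trans hu)
      ((K.toM_cross t v hvi).trans hv) :=
  congrArg Path.Homotopic.Quotient.mk (Path.ext (funext fun τ =>
    (K.toM_cross t (punctured.segment u v τ) (segment_eq_zero hui hvi τ)).symm))

end segmentClass

variable {K} (hn : 3 ≤ n)

theorem toM_barycentre (t : T) :
    K.toM t (punctured.barycentre (by omega)) = K.dualVertex hn t := rfl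

/-- The path class from the barycentre of `σ_t` to its point `u`, with image `y` in `M`. -/
noncomputable def spoke {t : T} {u : punctured n} {y : K.M} (hu : K.toM t u = y) :
    Path.Homotopic.Quotient (K.dualVertex hn t) y :=
  segmentClass (toM_barycentre hn t) hu

theorem spoke_trans_segmentClass {t : T} {u v : punctured n} {y z : K.M} (hu : K.toM t u = y)
    (hv : K.toM t v = z) : (spoke hn hu).trans (segmentClass hu hv) = spoke hn hv :=
  segmentClass_trans _ _ _

theorem spoke_barycentre (t : T) : spoke hn (toM_barycentre hn t) = .refl (K.dualVertex hn t) :=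
  segmentClass_self _

theorem spoke_eq_dualEdge_trans_spoke (f : Facet n T) {u : punctured n} (hf : u.1.1 f.2 = 0)
    {y : K.M} (hu : K.toM f.1 u = y) :
    spoke hn hu = (Path.Homotopic.Quotient.mk (K.dualEdge hn f)).trans
      (spoke hn ((K.toM_cross f.1 u hf).trans hu)) := by
  have permute_facet : punctured.permute (K.perspectivity f) (punctured.facetBarycentre hn f.2) =
      punctured.facetBarycentre hn (K.partner f).2 := by
    rw [← K.perspectivity_opposite]
    exact Subtype.ext (permute_facetBarycentre hn _ _)
  have hp : K.toM f.1 (punctured.facetBarycentre hn f.2) = K.facetPoint hn f := rfl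
  have hp' : K.toM (K.partner f).1 (punctured.facetBarycentre hn (K.partner f).2) =
    K.facetPoint hn f := K.facetPoint_partner hn f
  have hu' : K.toM (K.partner f).1 (punctured.permute (K.perspectivity f) u) = y :=
    (K.toM_cross f.1 u hf).trans hu
  calc spoke hn hu = (spoke hn hp).trans (segmentClass hp hu) :=
        (spoke_trans_segmentClass hn hp hu).symm
    _ = (spoke hn hp).trans (segmentClass hp' hu') := by
        rw [segmentClass_cross (facetBarycentre_self hn f.2) hf hp hu]
        congr 2
    _ = ((spoke hn hp).trans (spoke hn hp').symm).trans (spoke hn hu') := by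
        rw [Path.Homotopic.Quotient.trans_assoc, spoke, spoke, spoke, segmentClass_symm,
          segmentClass_trans]

end Triangulation

theorem trans_apply_eq_of_apply_eq {X Y Z : Type*} [TopologicalSpace X] [TopologicalSpace Y]
    {f : X → Z} {g : Y → Z} {x₁ x₂ x₃ : X} {y₁ y₂ y₃ : Y} {p : Path x₁ x₂} {p' : Path x₂ x₃}
    {q : Path y₁ y₂} {q' : Path y₂ y₃} (h : ∀ τ, f (p τ) = g (q τ)) (h' : ∀ τ, f (p' τ) = g (q' τ))
    (τ : unitInterval) : f (p.trans p' τ) = g (q.trans q' τ) := by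
  rw [Path.trans_apply, Path.trans_apply]
  split_ifs
  · exact h _
  · exact h' _

namespace Triangulation

variable {n : ℕ} {T : Type*} {K : Triangulation n T}

namespace DualPath

/-- Concatenation of edge paths. -/
def append : {t t' t'' : T} → K.DualPath t t' → K.DualPath t' t'' → K.DualPath t t''
  | _, _, _, .nil _, δ => δ
  | _, _, _, .cons f rest, δ => .cons f (rest.append δ)

/-- The edge path that crosses a single facet. -/
def single (f : Facet n T) : K.DualPath f.1 (K.partner f).1 := .cons f (.nil _)

variable {t t' t'' : T}

theorem projectivity_append (γ : K.DualPath t t') (δ : K.DualPath t' t'') :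
    (γ.append δ).projectivity = δ.projectivity * γ.projectivity := by
  induction γ with
  | nil => rfl
  | cons f rest ih => exact (congrArg (· * K.perspectivity f) (ih δ)).trans (mul_assoc _ _ _)

theorem projectivity_single (f : Facet n T) :
    (single (K := K) f).projectivity = K.perspectivity f := one_mul _

variable (hn : 3 ≤ n)

theorem mk_toPath_append (γ : K.DualPath t t') (δ : K.DualPath t' t'') :
    Path.Homotopic.Quotient.mk ((γ.append δ).toPath hn) =
      (Path.Homotopic.Quotient.mk (γ.toPath hn)).trans (.mk (δ.toPath hn)) := by
  induction γ with
  | nil => exact (Path.Homotopic.Quotient.refl_trans _).symm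
  | cons f rest ih =>
    exact (congrArg (Path.Homotopic.Quotient.mk (K.dualEdge hn f)).trans (ih δ)).trans
      (Path.Homotopic.Quotient.trans_assoc _ _ _).symm

theorem mk_toPath_single (f : Facet n T) :
    Path.Homotopic.Quotient.mk ((single (K := K) f).toPath hn) = .mk (K.dualEdge hn f) :=
  Path.Homotopic.Quotient.trans_refl (.mk (K.dualEdge hn f))

end DualPath

open Simplex

variable (hn : 3 ≤ n)

variable (K) in
theorem sheet_facetBarycentre (f : Facet n T) (s : Perm (Fin (n + 1))) :
    K.sheet (K.partner f).1 (K.perspectivity f * s) (facetBarycentre hn (K.partner f).2) =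
      K.sheet f.1 s (facetBarycentre hn f.2) := by
  rw [← K.perspectivity_opposite, ← permute_facetBarycentre]
  exact K.sheet_cross _ _ _ (facetBarycentre_self hn _)

variable (K) in
/-- The lift of half an edge of the dual graph to a labelled simplex. -/
noncomputable def liftHalfEdge (f : Facet n T) (s : Perm (Fin (n + 1))) :
    Path (K.sheet f.1 s (barycentre n)) (K.sheet f.1 s (facetBarycentre hn f.2)) where
  toFun τ := K.sheet f.1 s (segmentPoint hn f.2 τ)
  continuous_toFun := K.unfolding.continuous_proj.comp
    (continuous_sigmaMk.comp (continuous_segmentPoint hn f.2))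
  source' := by rw [segmentPoint_zero]
  target' := by rw [segmentPoint_one]

theorem DualPath.exists_lift {t t' : T} (γ : K.DualPath t t') (s : Perm (Fin (n + 1))) :
    ∃ Γ : Path (K.sheet t s (barycentre n)) (K.sheet t' (γ.projectivity * s) (barycentre n)),
      ∀ τ, K.fold (Γ τ) = (γ.toPath hn τ).1 := by
  induction γ generalizing s with
  | nil t => exact ⟨(Path.refl _).cast rfl (by rw [projectivity, one_mul]), fun _ => rfl⟩
  | cons f rest ih =>
    obtain ⟨Γ, hΓ⟩ := ih (K.perspectivity f * s)
    let edge := (K.liftHalfEdge hn f s).trans ((K.liftHalfEdge hn (K.partner f)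
      (K.perspectivity f * s)).symm.cast (K.sheet_facetBarycentre hn f s).symm rfl)
    have fold_edge : ∀ τ, K.fold (edge τ) = (K.dualEdge hn f τ).1 :=
      trans_apply_eq_of_apply_eq (g := Subtype.val) (fun _ => rfl) fun _ => rfl
    exact ⟨(edge.trans Γ).cast rfl (by rw [projectivity, mul_assoc]),
      trans_apply_eq_of_apply_eq (g := Subtype.val) (q' := rest.toPath hn) fold_edge hΓ⟩

theorem exists_dualPath_of_sheet_eq {t t' : T} {s s' : Perm (Fin (n + 1))} {u u' : punctured n}
    {y : K.M} (hu : K.toM t u = y) (hu' : K.toM t' u' = y)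
    (h : K.sheet t s u.1 = K.sheet t' s' u'.1) :
    ∃ δ : K.DualPath t t', δ.projectivity * s = s' ∧
      spoke hn hu = (Path.Homotopic.Quotient.mk (δ.toPath hn)).trans (spoke hn hu') := by
  obtain ⟨a', ha'⟩ := u'
  change K.sheet t s u.1 = K.sheet t' s' a' at h
  revert ha' hu'
  refine K.sheet_eq_induction ?_ ?_ h
  · exact fun _ _ => ⟨.nil t, one_mul s, (Path.Homotopic.Quotient.refl_trans _).symm⟩
  · intro t' s' a' i ih hi ha' hu'
    have ha : a' ∈ punctured n := fun j => by
      simpa only [permute_apply_apply] using ha' (K.perspectivity (t', i) j)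
    obtain ⟨δ, hδ, hspoke⟩ := ih ha ((K.toM_cross t' ⟨a', ha⟩ hi).symm.trans hu')
    refine ⟨δ.append (.single (t', i)), ?_, ?_⟩
    · rw [DualPath.projectivity_append, DualPath.projectivity_single, mul_assoc, hδ]
    · rw [hspoke, DualPath.mk_toPath_append, DualPath.mk_toPath_single,
        Path.Homotopic.Quotient.trans_assoc]
      exact congrArg _ (spoke_eq_dualEdge_trans_spoke hn (t', i) hi _)

theorem exists_dualPath_of_toM_eq {t t' : T} {u u' : punctured n} {y : K.M} (hu : K.toM t u = y)
    (hu' : K.toM t' u' = y) : ∃ δ : K.DualPath t t',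
      spoke hn hu = (Path.Homotopic.Quotient.mk (δ.toPath hn)).trans (spoke hn hu') := by
  obtain ⟨s', hs'⟩ := K.exists_sheet_eq (congrArg Subtype.val (hu.trans hu'.symm)) 1
  obtain ⟨δ, -, hδ⟩ := exists_dualPath_of_sheet_eq hn hu hu' hs'
  exact ⟨δ, hδ⟩

end Triangulation

theorem continuous_sigma_mk {X T S : Type*} [TopologicalSpace X]
    [TopologicalSpace S] {f : X → T} {g : X → S} (hf : IsLocallyConstant f) (hg : Continuous g) :
    Continuous fun x => (⟨f x, g x⟩ : Σ _ : T, S) := by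
  refine continuous_iff_continuousAt.2 fun x => ?_
  refine ((continuous_sigmaMk (σ := fun _ : T => S) (i := f x)).comp hg).continuousAt.congr ?_
  filter_upwards [hf.eventually_eq x] with y hy
  rw [hy, Function.comp_apply]

theorem isLocallyConstant_sigma_fst {T : Type*} {S : T → Type*} [∀ t, TopologicalSpace (S t)] :
    IsLocallyConstant (Sigma.fst : (Σ t, S t) → T) := fun s =>
  isOpen_sigma_iff.2 fun t => (isOpen_const : IsOpen {_a : S t | t ∈ s})

namespace Triangulation

open Simplex

variable {n : ℕ} {T : Type*} {K : Triangulation n T} {x : K.Space} {ε : ℝ}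

/-- The centre of the ball of `near x ε` in which `b` lies. -/
noncomputable def nearest (b : K.near x ε) : Simplex n := b.2.choose

theorem proj_nearest (b : K.near x ε) : K.proj ⟨b.1.1, nearest b⟩ = x := b.2.choose_spec.1

theorem dist_nearest_lt (b : K.near x ε) : dist b.1.2 (nearest b) < ε := b.2.choose_spec.2

/-- The radial motion of the points of `near x ε` to the centres of their balls. -/
noncomputable def radialPoint (b : K.near x ε) (τ : unitInterval) : K.near x ε :=
  ⟨⟨b.1.1, segment b.1.2 (nearest b) τ⟩, nearest b, proj_nearest b,
    dist_segment_lt (dist_nearest_lt b) τ⟩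

theorem radialPoint_zero (b : K.near x ε) : radialPoint b 0 = b :=
  Subtype.ext (congrArg (Sigma.mk b.1.1) (segment b.1.2 (nearest b)).source)

theorem proj_radialPoint_one (b : K.near x ε) : K.proj (radialPoint b 1) = x :=
  (congrArg (fun a => K.proj ⟨b.1.1, a⟩) (segment b.1.2 (nearest b)).target).trans (proj_nearest b)

namespace IsSmallRadius

section

variable (h : K.IsSmallRadius x ε)
include h

theorem nearest_eq {b : K.near x ε} {a : Simplex n} (ha : K.proj ⟨b.1.1, a⟩ = x)
    (hb : dist b.1.2 a < ε) : nearest b = a :=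
  h.eq_of_near (proj_nearest b) ha (dist_nearest_lt b) hb

theorem isLocallyConstant_nearest : IsLocallyConstant (nearest : K.near x ε → Simplex n) := by
  refine (IsLocallyConstant.iff_exists_open _).2 fun b => ?_
  let ball : Set K.Points := Sigma.mk b.1.1 '' Metric.ball (nearest b) ε
  have isOpen_ball : IsOpen ball := isOpenMap_sigmaMk _ Metric.isOpen_ball
  refine ⟨Subtype.val ⁻¹' ball, isOpen_ball.preimage continuous_subtype_val,
    ⟨b.1.2, dist_nearest_lt b, rfl⟩, ?_⟩
  rintro ⟨_, hc⟩ ⟨c, hcb, rfl⟩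
  exact h.nearest_eq (proj_nearest b) hcb

theorem continuous_radialPoint :
    Continuous fun p : K.near x ε × unitInterval => radialPoint p.1 p.2 := by
  have continuous_snd : Continuous (Sigma.snd : K.Points → Simplex n) :=
    continuous_sigma fun _ => continuous_id
  have continuous_nearest : Continuous (nearest : K.near x ε → Simplex n) :=
    h.isLocallyConstant_nearest.continuous
  have isLocallyConstant_simplex : IsLocallyConstant
      fun p : K.near x ε × unitInterval => p.1.1.1 :=
    isLocallyConstant_sigma_fst.comp_continuous
      (continuous_subtype_val.comp continuous_fst)
  have continuous_barycentric : Continuous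
      fun p : K.near x ε × unitInterval => segment p.1.1.2 (nearest p.1) p.2 :=
    continuous_segment.comp (by fun_prop :
      Continuous fun p : K.near x ε × unitInterval => ((p.1.1.2, nearest p.1), p.2))
  exact (continuous_sigma_mk isLocallyConstant_simplex continuous_barycentric).subtype_mk _

theorem proj_radialPoint_eq {b b' : K.near x ε} (hbb : K.proj b = K.proj b') (τ : unitInterval) :
    K.proj (radialPoint b τ) = K.proj (radialPoint b' τ) := by
  refine K.proj_eq_induction (p := fun c => ∀ hc : c ∈ K.near x ε,
    K.proj (radialPoint b τ) = K.proj (radialPoint ⟨c, hc⟩ τ)) (fun _ => rfl) ?_ hbb b'.2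
  rintro ⟨t, c⟩ i ih hi hc'
  have hc : ⟨t, c⟩ ∈ K.near x ε := h.mem_near_of_proj_eq hc' (K.proj_cross t c hi)
  have nearest_zero := h.eq_zero_of_near (proj_nearest ⟨_, hc⟩) (dist_nearest_lt ⟨_, hc⟩) hi
  have nearest_cross : nearest ⟨_, hc'⟩ = permute (K.perspectivity (t, i)) (nearest ⟨_, hc⟩) :=
    h.nearest_eq ((K.proj_cross t _ nearest_zero).trans (proj_nearest ⟨_, hc⟩))
      ((dist_permute_le _ _ _).trans_lt (dist_nearest_lt ⟨_, hc⟩))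
  have radialPoint_cross : (radialPoint ⟨_, hc'⟩ τ : K.Points) = ⟨(K.partner (t, i)).1,
      permute (K.perspectivity (t, i)) (segment c (nearest ⟨_, hc⟩) τ)⟩ := by
    rw [permute_segment, ← nearest_cross]
    rfl
  rw [ih hc, radialPoint_cross]
  exact (K.proj_cross t _ (segment_eq_zero hi nearest_zero τ)).symm

theorem contractibleSpace_image_near : ContractibleSpace (K.proj '' K.near x ε) := by
  let q : C(K.near x ε, K.proj '' K.near x ε) := ⟨fun b => ⟨K.proj b, b, b.2, rfl⟩,
    (K.continuous_proj.comp continuous_subtype_val).subtype_mk _⟩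
  have quotientMap : IsQuotientMap q :=
    ((isQuotientMap_quot_mk : IsQuotientMap K.proj).restrictPreimage_isOpen
      h.isOpen_image_near).comp (Homeomorph.setCongr h.preimage_image_near.symm).isQuotientMap
  let H : C(K.near x ε × unitInterval, K.proj '' K.near x ε) :=
    ⟨fun p => q (radialPoint p.1 p.2), q.continuous.comp h.continuous_radialPoint⟩
  have factorsThrough : Function.FactorsThrough H.curry q := fun b b' hbb =>
    ContinuousMap.ext fun τ => Subtype.ext (h.proj_radialPoint_eq (congrArg Subtype.val hbb) τ)
  let G : C(K.proj '' K.near x ε, C(unitInterval, K.proj '' K.near x ε)) :=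
    quotientMap.lift H.curry factorsThrough
  have G_apply : ∀ b τ, G (q b) τ = q (radialPoint b τ) := fun b τ =>
    DFunLike.congr_fun (DFunLike.congr_fun (quotientMap.lift_comp H.curry factorsThrough) b) τ
  obtain ⟨⟨t, a⟩, rfl⟩ := Quot.exists_rep x
  refine contractibleSpace_of_contraction G.uncurry ⟨_, _, h.mem_near rfl, rfl⟩ ?_ ?_
  · rintro ⟨_, b, hb, rfl⟩
    exact (G_apply ⟨b, hb⟩ 0).trans (congrArg q (radialPoint_zero _))
  · rintro ⟨_, b, hb, rfl⟩
    exact (G_apply ⟨b, hb⟩ 1).trans (Subtype.ext (proj_radialPoint_one _))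

end

variable {x : K.M} (h : K.IsSmallRadius x.1 ε)
include h

theorem notMem_image_skeleton_zero {y : K.Space} (hy : y ∈ K.proj '' K.near x.1 ε) :
    y ∉ K.proj '' K.skeleton 0 := by
  rintro ⟨c, hc, rfl⟩
  let c' : K.near x.1 ε := ⟨c, h.preimage_image_near.subset hy⟩
  obtain ⟨i, hi⟩ := K.mem_skeleton_zero.1 hc
  exact x.2 ⟨_, K.mem_skeleton_zero.2 ⟨i, fun j hj => h.eq_zero_of_near (proj_nearest c')
    (dist_nearest_lt c') (hi j hj)⟩, proj_nearest c'⟩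

theorem mem_image_near : x.1 ∈ K.proj '' K.near x.1 ε := by
  obtain ⟨t, a, rfl⟩ := K.exists_toM_eq x
  exact ⟨_, h.mem_near rfl, rfl⟩

theorem exists_radialPath {t : T} {u : punctured n}
    (hu : K.proj ⟨t, u.1⟩ ∈ K.proj '' K.near x.1 ε) :
    ∃ (v : punctured n) (_ : K.toM t v = x)
      (ρ : Path (⟨_, hu⟩ : K.proj '' K.near x.1 ε) ⟨_, h.mem_image_near⟩),
      ∀ τ, (ρ τ).1 = (K.toM t (punctured.segment u v τ)).1 := by
  let b : K.near x.1 ε := ⟨⟨t, u.1⟩, h.preimage_image_near.subset hu⟩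
  refine ⟨⟨nearest b, K.notMem_skeleton_zero_iff.1 fun hm => x.2 ⟨_, hm, proj_nearest b⟩⟩,
    Subtype.ext (proj_nearest b), ⟨⟨fun τ => ⟨_, _, (radialPoint b τ).2, rfl⟩, ?_⟩, ?_, ?_⟩,
    fun _ => rfl⟩
  · exact ((K.continuous_proj.comp continuous_sigmaMk).comp
      (segment u.1 (nearest b)).continuous).subtype_mk _
  · exact Subtype.ext (congrArg (K.proj ∘ Subtype.val) (radialPoint_zero b))
  · exact Subtype.ext (proj_radialPoint_one b)

/-- The radial motion of `near x ε` contracts its image in `M` to the point `x`. -/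
theorem exists_mk_eq_segmentClass_trans {y z : K.M} (α : Path y z)
    (hα : ∀ s, (α s).1 ∈ K.proj '' K.near x.1 ε) {t t' : T} {u u' : punctured n}
    (hu : K.toM t u = y) (hu' : K.toM t' u' = z) :
    ∃ (v v' : punctured n) (hv : K.toM t v = x) (hv' : K.toM t' v' = x),
      Path.Homotopic.Quotient.mk α = (segmentClass hu hv).trans (segmentClass hv' hu') := by
  subst hu hu'
  have hu : K.proj ⟨t, u.1⟩ ∈ K.proj '' K.near x.1 ε := by
    have := hα 0
    rwa [α.source] at this
  have hu' : K.proj ⟨t', u'.1⟩ ∈ K.proj '' K.near x.1 ε := by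
    have := hα 1
    rwa [α.target] at this
  obtain ⟨v, hv, ρ, hρ⟩ := h.exists_radialPath hu
  obtain ⟨v', hv', ρ', hρ'⟩ := h.exists_radialPath hu'
  refine ⟨v, v', hv, hv', ?_⟩
  let inclusion : C(K.proj '' K.near x.1 ε, K.M) :=
    ⟨fun w => ⟨w.1, h.notMem_image_skeleton_zero w.2⟩, continuous_subtype_val.subtype_mk _⟩
  let α' : Path (⟨_, hu⟩ : K.proj '' K.near x.1 ε) ⟨_, hu'⟩ :=
    ⟨⟨fun s => ⟨(α s).1, hα s⟩, (continuous_subtype_val.comp α.continuous).subtype_mk _⟩,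
      Subtype.ext (congrArg Subtype.val α.source :), Subtype.ext (congrArg Subtype.val α.target :)⟩
  have := h.contractibleSpace_image_near
  have homotopic' : α'.Homotopic (ρ.trans ρ'.symm) := SimplyConnectedSpace.paths_homotopic _ _
  let radial : Path (K.toM t u) x := ρ.map inclusion.continuous
  let radial' : Path (K.toM t' u') x := ρ'.map inclusion.continuous
  have homotopic : α.Homotopic (radial.trans radial'.symm) := by
    have := homotopic'.map inclusion
    rwa [Path.map_trans] at this
  calc Path.Homotopic.Quotient.mk α
      = (Path.Homotopic.Quotient.mk radial).trans (Path.Homotopic.Quotient.mk radial').symm :=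
        Path.Homotopic.Quotient.eq.2 homotopic
    _ = (segmentClass rfl hv).trans (segmentClass rfl hv').symm := by
        rw [mk_eq_segmentClass rfl hv _ radial fun τ => Subtype.ext (hρ τ),
          mk_eq_segmentClass rfl hv' _ radial' fun τ => Subtype.ext (hρ' τ)]
    _ = (segmentClass rfl hv).trans (segmentClass hv' rfl) := by rw [segmentClass_symm]

end IsSmallRadius

end Triangulation

namespace Triangulation

open Simplex

variable {n : ℕ} {T : Type*} {K : Triangulation n T} (hn : 3 ≤ n)

/-- The class `q` is carried by the dual graph: preceded and followed by straight paths from and to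
barycentres of simplices that contain its endpoints, it becomes the class of an edge path. -/
def IsDualClass {y z : K.M} (q : Path.Homotopic.Quotient y z) : Prop :=
  ∀ ⦃t t' : T⦄ ⦃u u' : punctured n⦄ (hu : K.toM t u = y) (hu' : K.toM t' u' = z),
    ∃ δ : K.DualPath t t', (spoke hn hu).trans q =
      (Path.Homotopic.Quotient.mk (δ.toPath hn)).trans (spoke hn hu')

theorem isDualClass_refl (y : K.M) : IsDualClass hn (.refl y) := fun _ _ _ _ hu hu' => by
  obtain ⟨δ, hδ⟩ := exists_dualPath_of_toM_eq hn hu hu'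
  exact ⟨δ, (Path.Homotopic.Quotient.trans_refl _).trans hδ⟩

theorem isDualClass_cast {y y' z z' : K.M} (α : Path y z) (hy : y' = y) (hz : z' = z) :
    IsDualClass hn (.mk (α.cast hy hz)) ↔ IsDualClass hn (.mk α) := by
  subst hy hz
  rfl

variable {hn} in
theorem IsDualClass.trans {x y z : K.M} {q : Path.Homotopic.Quotient x y}
    {r : Path.Homotopic.Quotient y z} (hq : IsDualClass hn q) (hr : IsDualClass hn r) :
    IsDualClass hn (q.trans r) := fun t t'' u u'' hu hu'' => by
  obtain ⟨t', u', hu'⟩ := K.exists_toM_eq y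
  obtain ⟨δ, hδ⟩ := hq hu hu'
  obtain ⟨δ', hδ'⟩ := hr hu' hu''
  refine ⟨δ.append δ', ?_⟩
  rw [DualPath.mk_toPath_append, ← Path.Homotopic.Quotient.trans_assoc, hδ,
    Path.Homotopic.Quotient.trans_assoc, hδ', Path.Homotopic.Quotient.trans_assoc]

theorem IsSmallRadius.isDualClass_mk {x : K.M} {ε : ℝ} (h : K.IsSmallRadius x.1 ε) {y z : K.M}
    (α : Path y z) (hα : ∀ s, (α s).1 ∈ K.proj '' K.near x.1 ε) : IsDualClass hn (.mk α) := by
  intro t t' u u' hu hu'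
  obtain ⟨v, v', hv, hv', mk_α⟩ := h.exists_mk_eq_segmentClass_trans α hα hu hu'
  obtain ⟨δ, hδ⟩ := exists_dualPath_of_toM_eq hn hv hv'
  refine ⟨δ, ?_⟩
  rw [mk_α, ← Path.Homotopic.Quotient.trans_assoc, spoke_trans_segmentClass, hδ,
    Path.Homotopic.Quotient.trans_assoc, spoke_trans_segmentClass]

theorem exists_subdivision_isDualClass {y z : K.M} (α : Path y z) :
    ∃ τ : ℕ → unitInterval, τ 0 = 0 ∧ (∃ m, τ m = 1) ∧
      ∀ k, IsDualClass hn (.mk (α.subpath (τ k) (τ (k + 1)))) := by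
  choose ε hε using fun x : K.M => K.exists_isSmallRadius x.1
  obtain ⟨τ, τ_zero, τ_mono, ⟨m, hm⟩, hτ⟩ := exists_monotone_Icc_subset_open_cover_unitInterval
    (c := fun x : K.M => {s | (α s).1 ∈ K.proj '' K.near x.1 (ε x)})
    (fun x => (hε x).isOpen_image_near.preimage (continuous_subtype_val.comp α.continuous))
    (fun s _ => Set.mem_iUnion.2 ⟨α s, (hε (α s)).mem_image_near⟩)
  refine ⟨τ, τ_zero, ⟨m, hm m le_rfl⟩, fun k => ?_⟩
  obtain ⟨x, hx⟩ := hτ k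
  refine (hε x).isDualClass_mk hn _ fun s => ?_
  have range_subpath := Path.range_subpath_of_le α _ _ (τ_mono k.le_succ)
  obtain ⟨r, hr, hrs⟩ := range_subpath.subset ⟨s, rfl⟩
  rw [← hrs]
  exact hx hr

theorem isDualClass_mk {y z : K.M} (α : Path y z) : IsDualClass hn (.mk α) := by
  obtain ⟨τ, τ_zero, ⟨m, τ_m⟩, hτ⟩ := exists_subdivision_isDualClass hn α
  have initial : ∀ k, IsDualClass hn (.mk (α.subpath 0 (τ k))) := by
    intro k
    induction k with
    | zero =>
      rw [τ_zero, Path.subpath_self]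
      exact isDualClass_refl hn _
    | succ k ih =>
      have := ih.trans (hτ k)
      rwa [← Path.Homotopic.Quotient.mk_trans,
        Path.Homotopic.Quotient.eq.2 ⟨Path.Homotopy.subpathTransSubpath α _ _ _⟩] at this
  have := initial m
  rwa [τ_m, Path.subpath_zero_one, isDualClass_cast] at this

theorem exists_dualPath_eq {t t' : T}
    (q : Path.Homotopic.Quotient (K.dualVertex hn t) (K.dualVertex hn t')) :
    ∃ δ : K.DualPath t t', Path.Homotopic.Quotient.mk (δ.toPath hn) = q := by
  obtain ⟨α, rfl⟩ := Path.Homotopic.Quotient.mk_surjective q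
  obtain ⟨δ, hδ⟩ := isDualClass_mk hn α (toM_barycentre hn t) (toM_barycentre hn t')
  refine ⟨δ, ?_⟩
  rwa [spoke_barycentre, spoke_barycentre, Path.Homotopic.Quotient.refl_trans,
    Path.Homotopic.Quotient.trans_refl, eq_comm] at hδ

end Triangulation

theorem semiconj_zpow {X Y : Type*} {g : Perm X} {g' : Perm Y} {f : X → Y}
    (h : Function.Semiconj f g g') : ∀ k : ℤ, Function.Semiconj f ⇑(g ^ k) ⇑(g' ^ k)
  | .ofNat m => by
    simpa only [Int.ofNat_eq_natCast, zpow_natCast, Perm.coe_pow] using h.iterate_right m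
  | .negSucc m => by
    have h' : Function.Semiconj f ⇑(g ^ (m + 1)) ⇑(g' ^ (m + 1)) := by
      simpa only [Perm.coe_pow] using h.iterate_right (m + 1)
    rw [zpow_negSucc, zpow_negSucc]
    exact h'.inverses_right (g ^ (m + 1)).right_inv (g' ^ (m + 1)).left_inv

/-- The half of the power that takes `x` to `r x` would take `x` to a fixed point of `r` or of
`c`, depending on the parity of the exponent. -/
theorem zpow_mul_apply_ne_of_involutions {X : Type*} {r c : Perm X} (hr : r * r = 1)
    (hc : c * c = 1) (hr' : ∀ x, r x ≠ x) (hc' : ∀ x, c x ≠ x) (k : ℤ) (x : X) :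
    ((r * c) ^ k) x ≠ r x := by
  have inv_r : r⁻¹ = r := inv_eq_of_mul_eq_one_left hr
  have inv_c : c⁻¹ = c := inv_eq_of_mul_eq_one_left hc
  have semiconj : SemiconjBy r (r * c) (r * c)⁻¹ := by
    rw [SemiconjBy, mul_inv_rev, inv_r, inv_c, mul_assoc, hr, mul_one, ← mul_assoc, hr, one_mul]
  have conj_zpow : ∀ m : ℤ, r * (r * c) ^ m = (r * c) ^ (-m) * r := fun m => by
    rw [zpow_neg, ← inv_zpow]
    exact semiconj.zpow_right m
  intro h
  have apply_half : ∀ m, r (((r * c) ^ m) x) = ((r * c) ^ (k - m)) x := fun m => by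
    rw [← Perm.mul_apply, conj_zpow, Perm.mul_apply, ← h, ← Perm.mul_apply, ← zpow_add,
      neg_add_eq_sub]
  rcases Int.even_or_odd' k with ⟨m, rfl | rfl⟩
  · refine hr' (((r * c) ^ m) x) ?_
    rw [apply_half, two_mul, add_sub_cancel_right]
  · refine hc' (((r * c) ^ m) x) (r.injective ?_)
    rw [apply_half, ← Perm.mul_apply r c, ← Perm.mul_apply, ← zpow_one_add]
    congr 2
    ring

namespace Triangulation

open Simplex

variable {n : ℕ} {T : Type*} (K : Triangulation n T)

/-- A face of codimension two of a simplex, with an order of the two facets that contain it. Both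
facets are recorded by their opposite corners. -/
@[ext] structure Flag (_K : Triangulation n T) where
  simplex : T
  first : Fin (n + 1)
  second : Fin (n + 1)
  first_ne_second : first ≠ second

variable {K}

namespace Flag

/-- The exchange of the two facets of a flag. -/
def flip (x : K.Flag) : K.Flag := ⟨x.simplex, x.second, x.first, x.first_ne_second.symm⟩

/-- The first facet of a flag. -/
def facet (x : K.Flag) : Facet n T := (x.simplex, x.first)

/-- The flag on the other side of the first facet of a flag. -/
def cross (x : K.Flag) : K.Flag :=
  ⟨(K.partner x.facet).1, K.perspectivity x.facet x.first, K.perspectivity x.facet x.second,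
    (K.perspectivity x.facet).injective.ne x.first_ne_second⟩

theorem flip_flip (x : K.Flag) : x.flip.flip = x := rfl

theorem facet_cross (x : K.Flag) : x.cross.facet = K.partner x.facet :=
  Prod.ext rfl (K.perspectivity_opposite x.facet)

theorem cross_cross (x : K.Flag) : x.cross.cross = x := by
  ext1
  · exact congrArg Prod.fst ((congrArg K.partner x.facet_cross).trans (K.partner_partner _))
  all_goals
    change K.perspectivity x.cross.facet (K.perspectivity x.facet _) = _
    rw [facet_cross, K.perspectivity_partner]
    exact (K.perspectivity x.facet).symm_apply_apply _

theorem flip_ne (x : K.Flag) : x.flip ≠ x := fun h => x.first_ne_second (congrArg second h)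

theorem cross_ne (x : K.Flag) : x.cross ≠ x := fun h =>
  K.partner_ne x.facet (x.facet_cross.symm.trans (congrArg facet h))

variable (K) in
/-- The rotation of the flags around their faces of codimension two. -/
def rotation : Perm K.Flag :=
  Function.Involutive.toPerm flip flip_flip * Function.Involutive.toPerm cross cross_cross

theorem rotation_apply (x : K.Flag) : rotation K x = x.cross.flip := rfl

theorem rotation_zpow_ne_flip (k : ℤ) (x : K.Flag) : (rotation K ^ k) x ≠ x.flip :=
  zpow_mul_apply_ne_of_involutions (Equiv.ext flip_flip) (Equiv.ext cross_cross) flip_ne cross_ne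
    k x

/-- The number of simplices around a face of codimension two, or `0` if there are infinitely
many. -/
noncomputable def period (x : K.Flag) : ℕ := Function.minimalPeriod (rotation K) x

theorem rotation_zpow_eq_self_iff {k : ℤ} {x : K.Flag} :
    (rotation K ^ k) x = x ↔ (x.period : ℤ) ∣ k :=
  MulAction.zpow_smul_eq_iff_minimalPeriod_dvd (a := rotation K) (b := x)

/-- The relative interior of the codimension two face of a flag. -/
def openFace (x : K.Flag) : Set K.Points :=
  {p | p.1 = x.simplex ∧ ∀ k, p.2.1 k = 0 ↔ k = x.first ∨ k = x.second}

theorem openFace_flip (x : K.Flag) : x.flip.openFace = x.openFace :=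
  Set.ext fun _ => and_congr_right fun _ => forall_congr' fun _ => iff_congr Iff.rfl or_comm

theorem cross_mem_openFace {x : K.Flag} {p : K.Points} (hp : p ∈ x.openFace) :
    ⟨(K.partner (p.1, x.first)).1, permute (K.perspectivity (p.1, x.first)) p.2⟩ ∈
      x.cross.openFace := by
  obtain ⟨t, a⟩ := p
  obtain ⟨rfl, ha⟩ := hp
  refine ⟨rfl, fun k => ?_⟩
  obtain ⟨k, rfl⟩ := (K.perspectivity x.facet).surjective k
  change (permute (K.perspectivity x.facet) a).1 _ = 0 ↔ _
  rw [permute_apply_apply, ha]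
  exact ((K.perspectivity x.facet).injective.eq_iff.or
    (K.perspectivity x.facet).injective.eq_iff).symm

theorem exists_mem_openFace {x : K.Flag} {p p' : K.Points} (hp : p ∈ x.openFace)
    (h : K.proj p = K.proj p') : ∃ k : ℤ, p' ∈ ((rotation K ^ k) x).openFace := by
  refine K.proj_eq_induction (p := fun p' => ∃ k : ℤ, p' ∈ ((rotation K ^ k) x).openFace)
    ⟨0, hp⟩ ?_ h
  rintro p' i ⟨k, hk⟩ hi
  rcases (hk.2 i).1 hi with rfl | rfl
  · refine ⟨1 + k, ?_⟩
    rw [zpow_one_add, Perm.mul_apply, rotation_apply, openFace_flip]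
    exact cross_mem_openFace hk
  · refine ⟨-1 + k, ?_⟩
    have rotation_inv : (rotation K ^ (-1 + k)) x = ((rotation K ^ k) x).flip.cross := by
      rw [zpow_add, zpow_neg_one, Perm.mul_apply, Perm.inv_eq_iff_eq, rotation_apply, cross_cross,
        flip_flip]
    rw [rotation_inv]
    rw [← openFace_flip] at hk
    exact cross_mem_openFace hk

theorem eq_or_eq_flip {x y : K.Flag} (hs : y.simplex = x.simplex)
    (hf : y.first = x.first ∨ y.first = x.second) (hs' : y.second = x.first ∨ y.second = x.second) :
    y = x ∨ y = x.flip := by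
  rcases hf with hf | hf <;> rcases hs' with hs' | hs'
  · exact absurd (hf.trans hs'.symm) y.first_ne_second
  · exact Or.inl (Flag.ext hs hf hs')
  · exact Or.inr (Flag.ext hs hf hs')
  · exact absurd (hf.trans hs'.symm) y.first_ne_second

theorem eq_or_eq_flip_of_mem_openFace {x y : K.Flag} {p : K.Points} (hx : p ∈ x.openFace)
    (hyf : p.1 = y.simplex) (hf : p.2.1 y.first = 0) (hs : p.2.1 y.second = 0) :
    y = x ∨ y = x.flip :=
  eq_or_eq_flip (hyf.symm.trans hx.1) ((hx.2 _).1 hf) ((hx.2 _).1 hs)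

/-- The codimension two face of a flag, given by its simplex and its corners. -/
def face (x : K.Flag) : T × Finset (Fin (n + 1)) := (x.simplex, {x.first, x.second}ᶜ)

theorem face_flip (x : K.Flag) : x.flip.face = x.face :=
  congrArg (fun F : Finset (Fin (n + 1)) => (x.simplex, Fᶜ)) (Finset.pair_comm _ _)

theorem face_eq_face_iff {x y : K.Flag} : y.face = x.face ↔ y = x ∨ y = x.flip := by
  refine ⟨fun h => ?_, ?_⟩
  · have corners_subset : {y.first, y.second} ⊆ ({x.first, x.second} : Finset (Fin (n + 1))) :=
      (compl_injective (congrArg Prod.snd h)).subset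
    simp only [Finset.insert_subset_iff, Finset.singleton_subset_iff, Finset.mem_insert,
      Finset.mem_singleton] at corners_subset
    exact eq_or_eq_flip (congrArg Prod.fst h) corners_subset.1 corners_subset.2
  · rintro (rfl | rfl)
    exacts [rfl, face_flip x]

theorem card_face (hn : 2 ≤ n) (x : K.Flag) : x.face.2.card = n - 2 + 1 := by
  rw [face, Finset.card_compl, Finset.card_pair x.first_ne_second, Fintype.card_fin]
  lia

theorem exists_face_eq {c : T × Finset (Fin (n + 1))} (hn : 2 ≤ n) (hc : c.2.card = n - 2 + 1) :
    ∃ x : K.Flag, x.face = c := by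
  have card_compl : c.2ᶜ.card = 2 := by
    rw [Finset.card_compl, hc, Fintype.card_fin]
    lia
  obtain ⟨i, j, hij, corners_eq⟩ := Finset.card_eq_two.1 card_compl
  exact ⟨⟨c.1, i, j, hij⟩, Prod.ext rfl (compl_eq_comm.1 corners_eq)⟩

/-- The image of the codimension two face of a flag. -/
def singlex (x : K.Flag) : Set K.Space := K.proj '' K.face x.face.1 x.face.2

theorem mem_singlex_iff {x : K.Flag} {z : K.Space} : z ∈ x.singlex ↔
    ∃ a : Simplex n, a.1 x.first = 0 ∧ a.1 x.second = 0 ∧ K.proj ⟨x.simplex, a⟩ = z := by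
  constructor
  · rintro ⟨⟨t, a⟩, ⟨rfl, ha⟩, rfl⟩
    exact ⟨a, ha _ (by simp [face]), ha _ (by simp [face]), rfl⟩
  · rintro ⟨a, hf, hs, rfl⟩
    refine ⟨_, ⟨rfl, fun j hj => ?_⟩, rfl⟩
    simp only [face, Finset.mem_compl, Finset.mem_insert, Finset.mem_singleton, not_not] at hj
    rcases hj with rfl | rfl
    exacts [hf, hs]

theorem singlex_flip (x : K.Flag) : x.flip.singlex = x.singlex := by
  rw [singlex, face_flip, singlex]

theorem singlex_subset_cross (x : K.Flag) : x.singlex ⊆ x.cross.singlex := by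
  intro z hz
  obtain ⟨a, hf, hs, rfl⟩ := mem_singlex_iff.1 hz
  exact mem_singlex_iff.2 ⟨permute (K.perspectivity x.facet) a,
    (permute_apply_apply _ _ _).trans hf, (permute_apply_apply _ _ _).trans hs,
    K.proj_cross x.simplex a hf⟩

theorem singlex_rotation (x : K.Flag) : (rotation K x).singlex = x.singlex := by
  rw [rotation_apply, singlex_flip]
  refine Set.Subset.antisymm ?_ x.singlex_subset_cross
  have := x.cross.singlex_subset_cross
  rwa [cross_cross] at this

theorem singlex_rotation_zpow (k : ℤ) (x : K.Flag) : ((rotation K ^ k) x).singlex = x.singlex := by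
  have := semiconj_zpow (g' := 1) (f := singlex) (singlex_rotation (K := K)) k x
  rwa [one_zpow] at this

/-- The barycentre of the codimension two face of a flag. -/
noncomputable def center (hn : 2 ≤ n) (x : K.Flag) : Simplex n :=
  ⟨fun k => if k = x.first ∨ k = x.second then 0 else 1 / ((n : ℝ) - 1), fun k => by
    have : (2 : ℝ) ≤ n := mod_cast hn
    dsimp only
    split_ifs
    exacts [le_rfl, div_nonneg zero_le_one (by linarith)], by
    have hn' : (2 : ℝ) ≤ n := mod_cast hn
    have nonzero_eq : (Finset.univ.filter fun k => ¬(k = x.first ∨ k = x.second)) =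
        ({x.first, x.second} : Finset (Fin (n + 1)))ᶜ := by
      ext k
      simp
    rw [Finset.sum_ite, Finset.sum_const_zero, zero_add, nonzero_eq, Finset.sum_const,
      Finset.card_compl, Finset.card_pair x.first_ne_second, Fintype.card_fin, nsmul_eq_mul,
      Nat.cast_sub (by lia)]
    push_cast
    have : (n : ℝ) - 1 ≠ 0 := by linarith
    field_simp
    ring⟩

theorem mk_center_mem_openFace (hn : 2 ≤ n) (x : K.Flag) :
    ⟨x.simplex, x.center hn⟩ ∈ x.openFace := by
  have hn' : (2 : ℝ) ≤ n := mod_cast hn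
  refine ⟨rfl, fun k => ?_⟩
  simp only [center, ite_eq_left_iff, div_eq_zero_iff, one_ne_zero, false_or]
  exact ⟨fun h => by_contra fun hk => by linarith [h hk], fun h h' => absurd h h'⟩

theorem center_flip (hn : 2 ≤ n) (x : K.Flag) : x.flip.center hn = x.center hn := by
  ext k
  exact if_congr or_comm rfl rfl

theorem center_cross (hn : 2 ≤ n) (x : K.Flag) :
    x.cross.center hn = permute (K.perspectivity x.facet) (x.center hn) := by
  ext k
  obtain ⟨k, rfl⟩ := (K.perspectivity x.facet).surjective k
  refine Eq.trans ?_ (permute_apply_apply _ _ _).symm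
  exact if_congr ((K.perspectivity x.facet).injective.eq_iff.or
    (K.perspectivity x.facet).injective.eq_iff) rfl rfl

theorem proj_center_rotation (hn : 2 ≤ n) (x : K.Flag) :
    K.proj ⟨(rotation K x).simplex, (rotation K x).center hn⟩ =
      K.proj ⟨x.simplex, x.center hn⟩ := by
  rw [rotation_apply, center_flip, center_cross]
  exact K.proj_cross x.simplex _ (((x.mk_center_mem_openFace hn).2 _).2 (Or.inl rfl))

theorem proj_center_rotation_zpow (hn : 2 ≤ n) (k : ℤ) (x : K.Flag) :
    K.proj ⟨((rotation K ^ k) x).simplex, ((rotation K ^ k) x).center hn⟩ =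
      K.proj ⟨x.simplex, x.center hn⟩ := by
  have := semiconj_zpow (g' := 1) (f := fun x : K.Flag => K.proj ⟨x.simplex, x.center hn⟩)
    (proj_center_rotation hn) k x
  rwa [one_zpow] at this

theorem center_mem_punctured (hn : 3 ≤ n) (x : K.Flag) :
    x.center (Nat.le_of_succ_le hn) ∈ punctured n := by
  have hn' : (3 : ℝ) ≤ n := mod_cast hn
  intro k
  change (if _ then _ else _) < (1 : ℝ)
  split_ifs
  · exact one_pos
  · rw [div_lt_one (by linarith)]
    linarith

theorem singlex_eq_iff (hn : 2 ≤ n) {x y : K.Flag} : y.singlex = x.singlex ↔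
    ∃ k : ℤ, y = (rotation K ^ k) x ∨ y = ((rotation K ^ k) x).flip := by
  constructor
  · intro h
    have hx := x.mk_center_mem_openFace hn
    have mem_singlex : K.proj ⟨x.simplex, x.center hn⟩ ∈ y.singlex :=
      h.ge (mem_singlex_iff.2
        ⟨_, (hx.2 _).2 (Or.inl rfl), (hx.2 _).2 (Or.inr rfl), rfl⟩)
    obtain ⟨b, hf, hs, hb⟩ := mem_singlex_iff.1 mem_singlex
    obtain ⟨k, hk⟩ := exists_mem_openFace hx hb.symm
    exact ⟨k, eq_or_eq_flip_of_mem_openFace hk rfl hf hs⟩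
  · rintro ⟨k, rfl | rfl⟩
    · exact singlex_rotation_zpow k x
    · rw [singlex_flip, singlex_rotation_zpow]

theorem degree_singlex (hn : 2 ≤ n) (x : K.Flag) : K.degree (n - 2) x.singlex = x.period := by
  let orbit : Set K.Flag := MulAction.orbit (Subgroup.zpowers (rotation K)) x
  have injOn_face : Set.InjOn face orbit := by
    rintro _ ⟨⟨_, k, rfl⟩, rfl⟩ _ ⟨⟨_, k', rfl⟩, rfl⟩ h
    refine (face_eq_face_iff.1 h).resolve_right fun h_flip => ?_
    refine rotation_zpow_ne_flip (k - k') ((rotation K ^ k') x) ?_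
    rw [← Perm.mul_apply, ← zpow_add, sub_add_cancel]
    exact h_flip
  have image_face : face '' orbit =
      {c | c.2.card = n - 2 + 1 ∧ K.proj '' K.face c.1 c.2 = x.singlex} := by
    ext c
    constructor
    · rintro ⟨_, ⟨⟨_, k, rfl⟩, rfl⟩, rfl⟩
      exact ⟨card_face hn _, singlex_rotation_zpow k x⟩
    · rintro ⟨hc, singlex_eq⟩
      obtain ⟨y, rfl⟩ := exists_face_eq (K := K) hn hc
      obtain ⟨k, hk⟩ := (singlex_eq_iff hn).1 singlex_eq
      exact ⟨_, ⟨⟨_, k, rfl⟩, rfl⟩, (face_eq_face_iff.2 hk).symm⟩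
  calc K.degree (n - 2) x.singlex
      = Nat.card (face '' orbit) := congrArg (fun S : Set _ => Nat.card S) image_face.symm
    _ = Nat.card orbit := Nat.card_image_of_injOn injOn_face
    _ = x.period := (Nat.card_congr (MulAction.orbitZPowersEquiv (rotation K) x)).trans
        (Nat.card_zmod _)

end Flag

theorem isEven_iff_even_period (hn : 2 ≤ n) : K.IsEven ↔ ∀ x : K.Flag, Even x.period := by
  constructor
  · intro h x
    rw [← x.degree_singlex hn]
    exact h _ ⟨_, _, x.card_face hn, rfl⟩
  · rintro h S ⟨t, F, hF, rfl⟩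
    obtain ⟨x, hx⟩ := Flag.exists_face_eq (K := K) (c := (t, F)) hn hF
    have := h x
    rwa [← x.degree_singlex hn, Flag.singlex, hx] at this

end Triangulation

theorem perm_eq_one_of_sign_eq_one {α : Type*} [Fintype α] [DecidableEq α]
    (hα : Fintype.card α ≤ 4) {σ : Perm α} {i j : α} (hij : i ≠ j) (hi : σ i = i) (hj : σ j = j)
    (hσ : Perm.sign σ = 1) : σ = 1 := by
  by_contra hne
  have support_subset : σ.support ⊆ {i, j}ᶜ := fun k hk => by
    rw [Finset.mem_compl, Finset.mem_insert, Finset.mem_singleton]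
    rintro (rfl | rfl)
    exacts [Perm.mem_support.1 hk hi, Perm.mem_support.1 hk hj]
  have card_le := Finset.card_le_card support_subset
  rw [Finset.card_compl, Finset.card_pair hij] at card_le
  have one_lt := Perm.one_lt_card_support_of_ne_one hne
  have swap := Perm.card_support_eq_two.1 (by lia : σ.support.card = 2)
  rw [swap.sign_eq] at hσ
  exact absurd hσ (by decide)

namespace Triangulation

open Simplex

variable {n : ℕ} {T : Type*} {K : Triangulation n T}

namespace Flag

/-- The flag below a flag of the complete unfolding. -/
def forget (y : K.unfolding.Flag) : K.Flag :=
  ⟨y.simplex.1, y.first, y.second, y.first_ne_second⟩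

/-- The flag of the complete unfolding in the simplex with label `s` over a flag. -/
def label (s : Perm (Fin (n + 1))) (x : K.Flag) : K.unfolding.Flag :=
  ⟨(x.simplex, s), x.first, x.second, x.first_ne_second⟩

theorem forget_rotation : Function.Semiconj forget (rotation K.unfolding) (rotation K) := by
  intro y
  simp only [rotation_apply, forget, flip, cross, unfolding_perspectivity]
  rfl

theorem forget_rotation_zpow (k : ℤ) (s : Perm (Fin (n + 1))) (x : K.Flag) :
    ((rotation K.unfolding ^ k) (x.label s)).forget = (rotation K ^ k) x :=
  semiconj_zpow forget_rotation k (x.label s)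

/-- The two corners that determine a flag of the complete unfolding, transported back by the
label of its simplex. -/
def labelledCorners (y : K.unfolding.Flag) : Fin (n + 1) × Fin (n + 1) :=
  (y.simplex.2⁻¹ y.first, y.simplex.2⁻¹ y.second)

theorem labelledCorners_rotation (y : K.unfolding.Flag) :
    (rotation K.unfolding y).labelledCorners = y.labelledCorners.swap := by
  have mul_inv_apply : ∀ (p s : Perm (Fin (n + 1))) k, (p * s)⁻¹ (p k) = s⁻¹ k := fun p s k => by
    rw [mul_inv_rev, Perm.mul_apply]
    exact congrArg _ (p.symm_apply_apply k)
  exact Prod.ext (mul_inv_apply _ _ _) (mul_inv_apply _ _ _)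

/-- The orientation of the simplex of a flag of the complete unfolding, compared with the one given
by its label. -/
def labelledOrientation (y : K.unfolding.Flag) : ℤˣ :=
  Perm.sign y.simplex.2 * K.orientation y.simplex.1

theorem labelledOrientation_rotation (y : K.unfolding.Flag) :
    (rotation K.unfolding y).labelledOrientation = -y.labelledOrientation := by
  have reversing := K.orientation_reversing (y.simplex.1, y.first)
  have square : K.orientation y.simplex.1 * K.orientation y.simplex.1 = 1 := Int.units_mul_self _
  change Perm.sign (K.perspectivity (y.simplex.1, y.first) * y.simplex.2) *
    K.orientation (K.partner (y.simplex.1, y.first)).1 = -(_ * _)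
  rw [Perm.sign_mul]
  generalize Perm.sign (K.perspectivity (y.simplex.1, y.first)) = p at *
  generalize K.orientation (K.partner (y.simplex.1, y.first)).1 = o' at *
  calc p * Perm.sign y.simplex.2 * o'
      = Perm.sign y.simplex.2 * K.orientation y.simplex.1 *
          (p * K.orientation y.simplex.1 * o') := by
        rw [← mul_one (p * _ * o'), ← square]
        ac_rfl
    _ = _ := by rw [reversing, mul_neg_one]

theorem labelled_rotation_zpow {k : ℤ} (hk : Even k) (y : K.unfolding.Flag) :
    ((rotation K.unfolding ^ k) y).labelledCorners = y.labelledCorners ∧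
      ((rotation K.unfolding ^ k) y).labelledOrientation = y.labelledOrientation := by
  obtain ⟨m, rfl⟩ := hk
  have invariant := semiconj_zpow (g := rotation K.unfolding ^ (2 : ℤ)) (g' := 1)
    (f := fun y => (labelledCorners y, labelledOrientation y)) (fun y => by
      simp only [zpow_two, Perm.mul_apply, labelledCorners_rotation, labelledOrientation_rotation,
        Prod.swap_swap, neg_neg, Perm.one_apply]) m y
  rw [one_zpow, ← zpow_mul, two_mul] at invariant
  exact ⟨congrArg Prod.fst invariant, congrArg Prod.snd invariant⟩

theorem exists_rotation_zpow_label_eq {x : K.Flag} {t : T} {s s' : Perm (Fin (n + 1))}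
    {a : Simplex n} (ha : ⟨t, a⟩ ∈ x.openFace) (h : K.sheet t s a = K.sheet t s' a) :
    ∃ k : ℤ, (rotation K.unfolding ^ k) (x.label s) = x.label s' := by
  obtain ⟨rfl, ha⟩ := ha
  have mem_label : ∀ r, ⟨(x.simplex, r), a⟩ ∈ (x.label r).openFace := fun r => ⟨rfl, ha⟩
  obtain ⟨k, hk⟩ := exists_mem_openFace (mem_label s) h
  refine ⟨k, (eq_or_eq_flip_of_mem_openFace (mem_label s') hk.1 ((hk.2 _).2 (Or.inl rfl))
    ((hk.2 _).2 (Or.inr rfl))).resolve_right fun eq_flip => ?_⟩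
  exact rotation_zpow_ne_flip k x
    ((forget_rotation_zpow k s x).symm.trans (congrArg forget eq_flip))

theorem mul_inv_apply_of_sheet_eq {x : K.Flag} (hx : Even x.period) {t : T}
    {s s' : Perm (Fin (n + 1))} {a : Simplex n} (ha : ⟨t, a⟩ ∈ x.openFace)
    (h : K.sheet t s a = K.sheet t s' a) :
    (s' * s⁻¹) x.first = x.first ∧ (s' * s⁻¹) x.second = x.second ∧
      Perm.sign (s' * s⁻¹) = 1 := by
  obtain ⟨k, hk⟩ := exists_rotation_zpow_label_eq ha h
  have period_dvd : (x.period : ℤ) ∣ k := by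
    rw [← rotation_zpow_eq_self_iff, ← forget_rotation_zpow k s x, hk]
    rfl
  obtain ⟨corners, orientation⟩ := labelled_rotation_zpow
    (((Int.even_coe_nat _).2 hx).trans_dvd period_dvd) (x.label s)
  rw [hk] at corners orientation
  have apply_eq : ∀ {i}, s'⁻¹ i = s⁻¹ i → (s' * s⁻¹) i = i := fun {i} hi => by
    rw [Perm.mul_apply, ← hi]
    exact s'.apply_symm_apply i
  have sign_eq : Perm.sign s' = Perm.sign s := mul_right_cancel orientation
  refine ⟨apply_eq (congrArg Prod.fst corners), apply_eq (congrArg Prod.snd corners), ?_⟩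
  rw [Perm.sign_mul, Perm.sign_inv, sign_eq, Int.units_mul_self]

end Flag

variable {t : T} {a : Simplex n}

theorem isUnramifiedAt_of_zeros_subsingleton (ha : {i | a.1 i = 0}.Subsingleton) :
    K.IsUnramifiedAt (K.proj ⟨t, a⟩) := by
  refine K.isUnramifiedAt_proj fun s s' h => ?_
  have simplex_eq : (t = t ∧ s' = s) ∨ ∃ i, a.1 i = 0 ∧ t = (K.partner (t, i)).1 ∧
      a = permute (K.perspectivity (t, i)) a := by
    have cases := K.sheet_eq_induction (p := fun t' s' a' => (t' = t ∧ s' = s ∧ a' = a) ∨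
      ∃ i, a.1 i = 0 ∧ t' = (K.partner (t, i)).1 ∧ s' = K.perspectivity (t, i) * s ∧
        a' = permute (K.perspectivity (t, i)) a) (Or.inl ⟨rfl, rfl, rfl⟩) ?_ h
    · exact cases.imp (fun h => ⟨h.1, h.2.1⟩) fun ⟨i, hi, ht, _, ha⟩ => ⟨i, hi, ht, ha⟩
    rintro t' s' a' i (⟨rfl, rfl, rfl⟩ | ⟨j, hj, rfl, rfl, rfl⟩) hi
    · exact Or.inr ⟨i, hi, rfl, rfl, rfl⟩
    · left
      have i_eq : i = (K.partner (t, j)).2 := by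
        obtain ⟨l, rfl⟩ := (K.perspectivity (t, j)).surjective i
        rw [permute_apply_apply] at hi
        rw [ha hi hj]
        exact K.perspectivity_opposite (t, j)
      have facet_eq : ((K.partner (t, j)).1, i) = K.partner (t, j) := Prod.ext rfl i_eq
      rw [facet_eq, K.partner_partner, K.perspectivity_partner, inv_mul_cancel_left,
        ← permute_mul, inv_mul_cancel, permute_one]
      exact ⟨rfl, rfl, rfl⟩
  rcases simplex_eq with ⟨-, hs⟩ | ⟨i, hi, ht, ha'⟩
  · exact hs.symm
  · have image_zero : a.1 (K.perspectivity (t, i) i) = 0 := by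
      rw [ha', permute_apply_apply, hi]
    have opposite_eq : (K.partner (t, i)).2 = i :=
      (K.perspectivity_opposite (t, i)).symm.trans (ha image_zero hi)
    exact absurd (Prod.ext ht.symm opposite_eq) (K.partner_ne (t, i))

theorem isUnramifiedAt_of_mem_openFace {x : K.Flag} (hx : Even x.period) (ha : ⟨t, a⟩ ∈ x.openFace)
    (h : ∀ k l, k ≠ x.first → k ≠ x.second → a.1 k = a.1 l → k = l) :
    K.IsUnramifiedAt (K.proj ⟨t, a⟩) := by
  refine K.isUnramifiedAt_proj fun s s' hs => ?_
  obtain ⟨first, second, -⟩ := Flag.mul_inv_apply_of_sheet_eq hx ha hs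
  rw [← mul_inv_eq_one.1 (Equiv.ext fun k => ?_ : s' * s⁻¹ = 1)]
  by_cases hf : k = x.first
  · rw [hf]; exact first
  by_cases hs' : k = x.second
  · rw [hs']; exact second
  refine (h k _ hf hs' ?_).symm
  conv_rhs => rw [K.eq_permute_of_sheet_eq hs]
  exact (permute_apply_apply _ _ _).symm

theorem exists_corners_of_not_isUnramifiedAt (hK : ∀ x : K.Flag, Even x.period)
    (h : ¬K.IsUnramifiedAt (K.proj ⟨t, a⟩)) :
    ∃ i j k l, i ≠ j ∧ k ≠ i ∧ k ≠ j ∧ k ≠ l ∧ a.1 i = 0 ∧ a.1 j = 0 ∧ a.1 k = a.1 l := by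
  obtain ⟨i, hi, j, hj, hij⟩ := Set.not_subsingleton_iff.1
    (mt isUnramifiedAt_of_zeros_subsingleton h)
  by_contra! distinct
  refine h (isUnramifiedAt_of_mem_openFace (hK ⟨t, i, j, hij⟩) ⟨rfl, fun k => ⟨fun hk => ?_, ?_⟩⟩
    fun k l hki hkj hkl => ?_)
  · by_contra! hne
    exact distinct i j k i hij hne.1 hne.2 hne.1 hi hj (hk.trans hi.symm)
  · rintro (rfl | rfl)
    exacts [hi, hj]
  · by_contra hne
    exact distinct i j k l hij hki hkj hne hi hj hkl

theorem isUnramifiedAt_of_eq_three {K : Triangulation 3 T} (hK : ∀ x : K.Flag, Even x.period)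
    (x : K.M) : K.IsUnramifiedAt x.1 := by
  obtain ⟨t, ⟨a, ha⟩, rfl⟩ := K.exists_toM_eq x
  by_cases hzeros : {i | a.1 i = 0}.Subsingleton
  · exact isUnramifiedAt_of_zeros_subsingleton hzeros
  obtain ⟨i, hi, j, hj, hij⟩ := Set.not_subsingleton_iff.1 hzeros
  let face : K.Flag := ⟨t, i, j, hij⟩
  have mem_openFace : ⟨t, a⟩ ∈ face.openFace := by
    refine ⟨rfl, fun k => ⟨fun hk => ?_, ?_⟩⟩
    · by_contra! hne
      obtain ⟨l, hl⟩ : ∃ l, ∀ m, m ≠ l → m = i ∨ m = j ∨ m = k :=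
        (by decide : ∀ i j k : Fin 4, i ≠ j → k ≠ i → k ≠ j →
          ∃ l, ∀ m, m ≠ l → m = i ∨ m = j ∨ m = k) i j k hij hne.1 hne.2
      refine (K.notMem_skeleton_zero_iff (x := ⟨t, a⟩)).2 ha (K.mem_skeleton_zero.2 ⟨l, ?_⟩)
      intro m hm
      rcases hl m hm with rfl | rfl | rfl
      exacts [hi, hj, hk]
    · rintro (rfl | rfl)
      exacts [hi, hj]
  refine K.isUnramifiedAt_proj fun s s' hs => ?_
  obtain ⟨first, second, sign⟩ := Flag.mul_inv_apply_of_sheet_eq (hK face) mem_openFace hs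
  exact (mul_inv_eq_one.1
    (perm_eq_one_of_sign_eq_one (Fintype.card_fin 4).le hij first second sign)).symm

theorem nonempty_dualPath [ConnectedSpace K.Space] (t t' : T) : Nonempty (K.DualPath t t') := by
  have reachable_iff : ∀ p q, K.Glued p q → (Nonempty (K.DualPath t p.1) ↔
      Nonempty (K.DualPath t q.1)) := by
    have reachable : ∀ {p q}, K.Glued p q → Nonempty (K.DualPath t p.1) →
        Nonempty (K.DualPath t q.1) := by
      rintro p q h ⟨δ⟩
      obtain ⟨i, -, rfl⟩ := K.glued_iff.1 h
      exact ⟨δ.append (.single (p.1, i))⟩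
    exact fun p q h => ⟨reachable h, reachable h.symm⟩
  let reachable : K.Space → Prop :=
    Quot.lift (fun p => Nonempty (K.DualPath t p.1)) fun p q h => propext (reachable_iff p q h)
  have locallyConstant : IsLocallyConstant reachable := fun S =>
    isOpen_coinduced.2 (isLocallyConstant_sigma_fst {t' | Nonempty (K.DualPath t t') ∈ S})
  have eq := locallyConstant.apply_eq_of_preconnectedSpace
    (K.proj ⟨t, barycentre n⟩) (K.proj ⟨t', barycentre n⟩)
  exact eq.mp ⟨.nil t⟩

theorem IsCanonicalRep.projectivity_eq_one [ConnectedSpace K.Space] {hn : 3 ≤ n} {t₀ : T}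
    {ρ : FundamentalGroup K.M (K.dualVertex hn t₀) →* Perm (Fin (n + 1))}
    (hρ : K.IsCanonicalRep hn t₀ ρ) {t : T} (γ : K.DualPath t t)
    (h : Path.Homotopic.Quotient.mk (γ.toPath hn) = .refl _) : γ.projectivity = 1 := by
  obtain ⟨α⟩ : Nonempty (K.DualPath t₀ t) := nonempty_dualPath t₀ t
  obtain ⟨β⟩ : Nonempty (K.DualPath t t₀) := nonempty_dualPath t t₀
  have apply_with := (hρ _ _).2 ⟨α.append (γ.append β), rfl, rfl⟩
  have apply_without := (hρ _ _).2 ⟨α.append β, rfl, rfl⟩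
  rw [DualPath.mk_toPath_append, DualPath.mk_toPath_append, h, Path.Homotopic.Quotient.refl_trans,
    ← DualPath.mk_toPath_append, apply_without] at apply_with
  simp only [DualPath.projectivity_append, mul_assoc] at apply_with
  exact right_eq_mul.1 (mul_left_cancel apply_with)

theorem IsCanonicalRep.isEven [ConnectedSpace K.Space] {hn : 3 ≤ n} {t₀ : T}
    {ρ : FundamentalGroup K.M (K.dualVertex hn t₀) →* Perm (Fin (n + 1))}
    (hρ : K.IsCanonicalRep hn t₀ ρ) : K.IsEven := by
  have two_le : 2 ≤ n := Nat.le_of_succ_le hn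
  refine (isEven_iff_even_period two_le).2 fun x => Nat.not_odd_iff_even.1 fun ⟨m, hm⟩ => ?_
  set y := (Flag.rotation K.unfolding ^ (x.period : ℤ)) (x.label 1) with hy
  obtain ⟨s, hs⟩ : ∃ s, y = x.label s :=
    ⟨y.simplex.2, congrArg (Flag.label y.simplex.2)
      ((Flag.forget_rotation_zpow _ 1 x).trans (Flag.rotation_zpow_eq_self_iff.2 dvd_rfl))⟩
  have s_eq_one : s = 1 := by
    have sheet_eq : K.sheet x.simplex 1 (x.center two_le) =
        K.sheet x.simplex s (x.center two_le) := by
      have := Flag.proj_center_rotation_zpow two_le x.period (x.label 1)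
      rw [← hy, hs] at this
      exact this.symm
    obtain ⟨δ, hδ, hspoke⟩ := exists_dualPath_of_sheet_eq hn
      (u := ⟨x.center two_le, x.center_mem_punctured hn⟩) rfl rfl sheet_eq
    rw [← hδ, mul_one]
    refine hρ.projectivity_eq_one δ ?_
    have := congrArg (fun q => q.trans (spoke hn rfl).symm) hspoke
    simpa only [Path.Homotopic.Quotient.trans_assoc, Path.Homotopic.Quotient.trans_symm,
      Path.Homotopic.Quotient.trans_refl] using this.symm
  have corners : y.labelledCorners = (x.label 1).labelledCorners.swap := by
    have period_eq : (x.period : ℤ) = 1 + 2 * m := by rw [hm]; push_cast; ring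
    rw [hy, period_eq, zpow_one_add, Perm.mul_apply, Flag.labelledCorners_rotation,
      (Flag.labelled_rotation_zpow (even_two_mul _) _).1]
  rw [hs, s_eq_one] at corners
  exact x.first_ne_second (congrArg Prod.fst corners)

end Triangulation

section Dimension

open Module

variable {k V W : Type*} [Field k] [AddCommGroup V] [Module k V] [AddCommGroup W] [Module k W]

theorem finrank_vectorSpan_image_le [FiniteDimensional k V] (L : V →ᵃ[k] W) (s : Set V) :
    finrank k (vectorSpan k (L '' s)) ≤ finrank k (vectorSpan k s) := by
  rw [← AffineMap.map_vectorSpan]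
  exact Submodule.finrank_map_le _ _

theorem finrank_vectorSpan_lt {E : Submodule k V} [FiniteDimensional k E] (φ : V →ₗ[k] k)
    {s : Set V} (hs : s.Nonempty) (hE : s ⊆ E)
    (hφ : ∀ x ∈ s, φ x = 1) : finrank k (vectorSpan k s) < finrank k E := by
  refine Submodule.finrank_lt_finrank_of_lt (lt_of_le_of_ne ?_ fun h => ?_)
  · rw [vectorSpan, Submodule.span_le]
    rintro _ ⟨x, hx, y, hy, rfl⟩
    exact E.sub_mem (hE hx) (hE hy)
  · obtain ⟨x, hx⟩ := hs
    have ker : vectorSpan k s ≤ LinearMap.ker φ := by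
      rw [vectorSpan, Submodule.span_le]
      rintro _ ⟨x, hx, y, hy, rfl⟩
      simp [hφ x hx, hφ y hy]
    exact one_ne_zero ((hφ x hx).symm.trans (ker (h ▸ hE hx)))

theorem finrank_add_card_le {ι : Type*} [Fintype ι] (E : Submodule k (ι → k)) (Q : Finset ι)
    (hE : ∀ x ∈ E, (∀ m ∉ Q, x m = 0) → x = 0) : finrank k E + Q.card ≤ Fintype.card ι := by
  classical
  let restrict := (LinearMap.funLeft k k (Subtype.val : {m // m ∉ Q} → ι)).domRestrict E
  have injective : Function.Injective restrict := by
    rw [← LinearMap.ker_eq_bot, LinearMap.ker_eq_bot']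
    exact fun x hx => Subtype.ext (hE x.1 x.2 fun m hm => congrFun hx ⟨m, hm⟩)
  have le := LinearMap.finrank_le_finrank_of_injective injective
  rw [finrank_fintype_fun_eq_card, Fintype.card_subtype_compl, Fintype.card_coe] at le
  have := Finset.card_le_univ Q
  omega

end Dimension

section Avoidance

open Module MeasureTheory

variable {F : Type*} [NormedAddCommGroup F] [NormedSpace ℝ F] [FiniteDimensional ℝ F]

theorem mem_affineSpan_sup_of_mem_segment {V : Type*} [AddCommGroup V] [Module ℝ V] {S ℓ : Set V}
    {c y z : V} (hy : y ∈ S) (hz : z ∈ ℓ) (hne : y ≠ z) (h : y ∈ segment ℝ c z) :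
    c ∈ affineSpan ℝ S ⊔ affineSpan ℝ ℓ := by
  rw [segment_symm, segment_eq_image_lineMap] at h
  obtain ⟨r, -, rfl⟩ := h
  have hr : r ≠ 0 := fun hr => hne (by rw [hr, AffineMap.lineMap_apply_zero])
  have hc : AffineMap.lineMap z (AffineMap.lineMap z c r) r⁻¹ = c := by
    rw [AffineMap.lineMap_lineMap_right, inv_mul_cancel₀ hr, AffineMap.lineMap_apply_one]
  rw [← hc]
  exact AffineMap.lineMap_mem _ (le_sup_right (a := affineSpan ℝ S) (subset_affineSpan ℝ ℓ hz))
    (le_sup_left (b := affineSpan ℝ ℓ) (subset_affineSpan ℝ S hy))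

theorem affineSpan_sup_ne_top {S ℓ : Set F} (hS : S.Nonempty) (hℓ : ℓ.Nonempty)
    (h : finrank ℝ (vectorSpan ℝ S) + finrank ℝ (vectorSpan ℝ ℓ) + 1 < finrank ℝ F) :
    affineSpan ℝ S ⊔ affineSpan ℝ ℓ ≠ ⊤ := by
  obtain ⟨y, hy⟩ := hS
  obtain ⟨z, hz⟩ := hℓ
  intro htop
  have direction_eq := AffineSubspace.direction_sup (subset_affineSpan ℝ S hy)
    (subset_affineSpan ℝ ℓ hz)
  rw [htop, AffineSubspace.direction_top, direction_affineSpan, direction_affineSpan]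
    at direction_eq
  have h₁ := Submodule.finrank_add_le_finrank_add_finrank (vectorSpan ℝ S ⊔ vectorSpan ℝ ℓ)
    (ℝ ∙ (z -ᵥ y))
  have h₂ := Submodule.finrank_add_le_finrank_add_finrank (vectorSpan ℝ S) (vectorSpan ℝ ℓ)
  have h₃ : finrank ℝ (ℝ ∙ (z -ᵥ y)) ≤ 1 := by
    simpa using finrank_span_le_card (R := ℝ) {z -ᵥ y}
  rw [← direction_eq, finrank_top] at h₁
  omega

theorem addHaar_apexes_eq_zero [MeasurableSpace F] [BorelSpace F] (μ : Measure F)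
    [μ.IsAddHaarMeasure] {S ℓ : Set F}
    (h : finrank ℝ (vectorSpan ℝ S) + finrank ℝ (vectorSpan ℝ ℓ) + 1 < finrank ℝ F) :
    μ {c | ∃ y ∈ S, ∃ z ∈ ℓ, y ≠ z ∧ y ∈ segment ℝ c z} = 0 := by
  by_cases hne : S.Nonempty ∧ ℓ.Nonempty
  · refine measure_mono_null ?_
      (Measure.addHaar_affineSubspace μ _ (affineSpan_sup_ne_top hne.1 hne.2 h))
    rintro c ⟨y, hy, z, hz, hyz, hc⟩
    exact mem_affineSpan_sup_of_mem_segment hy hz hyz hc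
  · convert! measure_empty (μ := μ)
    refine Set.eq_empty_of_forall_notMem ?_
    rintro c ⟨y, hy, z, hz, -⟩
    exact hne ⟨⟨y, hy⟩, z, hz⟩

theorem exists_mem_forall_segment_eq {ι : Type*} [Countable ι] {S ℓ : ι → Set F}
    (h : ∀ m, finrank ℝ (vectorSpan ℝ (S m)) + finrank ℝ (vectorSpan ℝ (ℓ m)) + 1 < finrank ℝ F)
    {V : Set F} (hV : IsOpen V) (hV_nonempty : V.Nonempty) :
    ∃ c ∈ V, ∀ m, ∀ y ∈ S m, ∀ z ∈ ℓ m, y ∈ segment ℝ c z → y = z := by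
  borelize F
  have null := measure_iUnion_null fun m => addHaar_apexes_eq_zero Measure.addHaar (h m)
  by_contra! hc
  refine (hV.measure_pos Measure.addHaar hV_nonempty).ne' (measure_mono_null (fun c hcV => ?_) null)
  obtain ⟨m, y, hy, z, hz, hyz, hne⟩ := hc c hcV
  exact Set.mem_iUnion.2 ⟨m, y, hy, z, hz, hne, hyz⟩

end Avoidance

namespace Simplex

open Module

variable {n : ℕ}

/-- The section by `x i = x j = 0` and `x k = x l` of the affine space spanned by the simplex. -/
def slice (i j k l : Fin (n + 1)) : Set (Fin (n + 1) → ℝ) :=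
  {x | ∑ m, x m = 1 ∧ x i = 0 ∧ x j = 0 ∧ x k = x l}

theorem finrank_vectorSpan_slice_add_three_le (hn : 3 ≤ n) {i j k l : Fin (n + 1)} (hij : i ≠ j)
    (hki : k ≠ i) (hkj : k ≠ j) (hkl : k ≠ l) :
    finrank ℝ (vectorSpan ℝ (slice i j k l)) + 3 ≤ n := by
  rcases (slice i j k l).eq_empty_or_nonempty with hempty | hne
  · rwa [hempty, vectorSpan_empty, finrank_bot, zero_add]
  let coord (m : Fin (n + 1)) : (Fin (n + 1) → ℝ) →ₗ[ℝ] ℝ := LinearMap.proj m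
  let E : Submodule ℝ (Fin (n + 1) → ℝ) :=
    LinearMap.ker (coord i) ⊓ LinearMap.ker (coord j) ⊓ LinearMap.ker (coord k - coord l)
  have mem_E {x : Fin (n + 1) → ℝ} : x ∈ E ↔ (x i = 0 ∧ x j = 0) ∧ x k = x l := by
    simp [E, coord, sub_eq_zero]
  have finrank_E : finrank ℝ E + 3 ≤ n + 1 := by
    have card_eq : ({i, j, k} : Finset (Fin (n + 1))).card = 3 :=
      Finset.card_eq_three.2 ⟨i, j, k, hij, hki.symm, hkj.symm, rfl⟩
    rw [← card_eq]
    refine (finrank_add_card_le E _ fun x hx off => funext fun m => ?_).trans_eq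
      (Fintype.card_fin _)
    obtain ⟨⟨hi, hj⟩, hk⟩ := mem_E.1 hx
    simp only [Finset.mem_insert, Finset.mem_singleton, not_or] at off
    have hl : x l = 0 := by
      by_contra hl
      exact hl (off l ⟨fun h => hl (h ▸ hi), fun h => hl (h ▸ hj), hkl.symm⟩)
    by_contra hm
    exact hm (off m ⟨fun h => hm (h ▸ hi), fun h => hm (h ▸ hj), fun h => hm (h ▸ hk.trans hl)⟩)
  have lt := finrank_vectorSpan_lt (∑ m, coord m) hne
    (fun x hx => (mem_E.2 ⟨⟨hx.2.1, hx.2.2.1⟩, hx.2.2.2⟩ : x ∈ E)) fun x hx => by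
      simpa [coord] using hx.1
  omega

end Simplex

namespace Simplex

open Module Triangulation

variable {n : ℕ} (hn : 3 ≤ n)

/-- Half an edge of the dual graph, contracted towards the point `a` of the simplex by the
factor `η`. -/
noncomputable def contractedHalfEdge (a : Simplex n) (i : Fin (n + 1)) (η : unitInterval) :
    Path (segment a (barycentre n) η) (segment a (facetBarycentre hn i) η) where
  toFun τ := segment a (segmentPoint hn i τ) η
  continuous_toFun := continuous_segment.comp (f := fun τ => ((a, segmentPoint hn i τ), η)) <|
    (continuous_const.prodMk (continuous_segmentPoint hn i)).prodMk continuous_const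
  source' := by rw [segmentPoint_zero]
  target' := by rw [segmentPoint_one]

theorem permute_segment_facetBarycentre (σ : Perm (Fin (n + 1))) (a : Simplex n) (i : Fin (n + 1))
    (η : unitInterval) : permute σ (segment a (facetBarycentre hn i) η) =
      segment (permute σ a) (facetBarycentre hn (σ i)) η := by
  rw [permute_segment, permute_facetBarycentre]

theorem contractedHalfEdge_pos (a : Simplex n) {i m : Fin (n + 1)} (hm : m ≠ i) {η : unitInterval}
    (hη : 0 < η.1) (τ : unitInterval) : 0 < (contractedHalfEdge hn a i η τ).1 m := by
  have h₁ := mul_pos hη (segmentPoint_pos hn i τ hm)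
  have h₂ := mul_nonneg (sub_nonneg.2 η.2.2) (a.2.1 m)
  exact add_pos_of_nonneg_of_pos h₂ h₁

theorem collinear_contractedHalfEdge (a : Simplex n) (i : Fin (n + 1)) (η : unitInterval) :
    Collinear ℝ (Set.range fun τ => (contractedHalfEdge hn a i η τ).1) := by
  refine (collinear_iff_exists_forall_eq_smul_vadd _).2
    ⟨(segment a (barycentre n) η).1, η.1 • ((facetBarycentre hn i).1 - (barycentre n).1), ?_⟩
  rintro _ ⟨τ, rfl⟩
  refine ⟨τ.1, ?_⟩
  change (1 - η.1) • a.1 + η.1 • ((1 - τ.1) • (barycentre n).1 + τ.1 • (facetBarycentre hn i).1) =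
    τ.1 • (η.1 • ((facetBarycentre hn i).1 - (barycentre n).1)) +
      ((1 - η.1) • a.1 + η.1 • (barycentre n).1)
  module

theorem contractedHalfEdge_mem_punctured {a : Simplex n} (ha : a ∈ punctured n) (i : Fin (n + 1))
    (η τ : unitInterval) : contractedHalfEdge hn a i η τ ∈ punctured n :=
  punctured.segment_mem ha (punctured.segment_mem
    (barycentre_mem_punctured (Nat.one_le_of_lt hn)) (facetBarycentre_mem_punctured hn i) τ) η

end Simplex

namespace Triangulation

open Simplex unitInterval

variable {n : ℕ} {T : Type*} {K : Triangulation n T} (hn : 3 ≤ n)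

/-- The image in the triangulated space of the half edges of the dual graph, contracted towards the
points of `P` by the factor `η`. -/
def contractedGraph (P : Set K.Points) (η : unitInterval) : Set K.Space :=
  {z | ∃ p ∈ P, ∃ i τ, z = K.proj ⟨p.1, contractedHalfEdge hn p.2 i η τ⟩}

theorem contractedGraph_mono {P Q : Set K.Points} (h : P ⊆ Q) (η : unitInterval) :
    contractedGraph hn P η ⊆ contractedGraph hn Q η := fun _ ⟨p, hp, hz⟩ => ⟨p, h hp, hz⟩

theorem joinedIn_contractedHalfEdge {P : Set K.Points} {t : T} {a : Simplex n} (ha : ⟨t, a⟩ ∈ P)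
    (s : Perm (Fin (n + 1))) (i : Fin (n + 1)) (η : unitInterval) :
    JoinedIn (K.fold ⁻¹' contractedGraph hn P η) (K.sheet t s (segment a (barycentre n) η))
      (K.sheet t s (segment a (facetBarycentre hn i) η)) :=
  have continuous_sheet : Continuous (K.sheet t s) :=
    K.unfolding.continuous_proj.comp continuous_sigmaMk
  ⟨(contractedHalfEdge hn a i η).map continuous_sheet, fun τ => ⟨_, ha, i, τ, rfl⟩⟩

/-- A chain of facets through `a` that leads from one labelled simplex to another is a path in the
dual graph; contracted towards the images of `a`, it lifts to a path close to the images of `a`. -/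
theorem exists_finite_joinedIn_contractedGraph {t t' : T} {s s' : Perm (Fin (n + 1))}
    {a a' : Simplex n} (h : K.sheet t s a = K.sheet t' s' a') :
    ∃ P : Set K.Points, P.Finite ∧ (∀ p ∈ P, K.proj p = K.proj ⟨t, a⟩) ∧ ∀ η,
      JoinedIn (K.fold ⁻¹' contractedGraph hn P η) (K.sheet t s (segment a (barycentre n) η))
        (K.sheet t' s' (segment a' (barycentre n) η)) := by
  refine (K.sheet_eq_induction (p := fun t' s' a' => K.proj ⟨t', a'⟩ = K.proj ⟨t, a⟩ ∧
    ∃ P : Set K.Points, P.Finite ∧ (∀ p ∈ P, K.proj p = K.proj ⟨t, a⟩) ∧ ∀ η,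
      JoinedIn (K.fold ⁻¹' contractedGraph hn P η) (K.sheet t s (segment a (barycentre n) η))
        (K.sheet t' s' (segment a' (barycentre n) η))) ⟨rfl, ?_⟩ ?_ h).2
  · have joined := joinedIn_contractedHalfEdge (K := K) hn (P := {⟨t, a⟩}) rfl s 0
    exact ⟨{⟨t, a⟩}, Set.finite_singleton _, fun p hp => congrArg _ hp,
      fun η => .refl (joined η).source_mem⟩
  · rintro t' s' a' i ⟨ha', P, hP, hproj, joined⟩ hi
    set π := K.perspectivity (t', i)
    let Q : Set K.Points := {⟨t', a'⟩, ⟨(K.partner (t', i)).1, permute π a'⟩}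
    have hcross := (K.proj_cross t' a' hi).trans ha'
    refine ⟨hcross, P ∪ Q, hP.union (by simp [Q]), ?_, fun η => ?_⟩
    · rintro p (hp | rfl | rfl)
      exacts [hproj p hp, ha', hcross]
    · have before := joinedIn_contractedHalfEdge hn (P := P ∪ Q) (.inr (.inl rfl)) s' i η
      have after := joinedIn_contractedHalfEdge hn (P := P ∪ Q) (.inr (.inr rfl)) (π * s') (π i) η
      rw [← permute_segment_facetBarycentre, K.sheet_cross _ _ _
        (segment_eq_zero hi (facetBarycentre_self hn i) η)] at after
      exact ((joined η).mono (Set.preimage_mono (contractedGraph_mono hn Set.subset_union_left η))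
        |>.trans before).trans after.symm

theorem isUnramifiedAt_of_mem_contractedGraph {P : Set K.Points} {η : unitInterval} (hη : 0 < η.1)
    {z : K.Space} (hz : z ∈ contractedGraph hn P η) : K.IsUnramifiedAt z := by
  obtain ⟨p, -, i, τ, rfl⟩ := hz
  have eq_of_zero {k} (hk : (contractedHalfEdge hn p.2 i η τ).1 k = 0) : k = i := by
    by_contra hne
    exact (contractedHalfEdge_pos hn p.2 hne hη τ).ne' hk
  exact isUnramifiedAt_of_zeros_subsingleton fun k hk l hl =>
    (eq_of_zero hk).trans (eq_of_zero hl).symm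

theorem eventually_proj_contractedHalfEdge_mem {t : T} {a : Simplex n} {x : K.M}
    (ha : K.proj ⟨t, a⟩ = x.1) {U : Set K.M} (hU : U ∈ 𝓝 x) (i : Fin (n + 1)) :
    ∀ᶠ η in 𝓝 (0 : I), ∀ τ,
      K.proj ⟨t, contractedHalfEdge hn a i η τ⟩ ∈ Subtype.val '' U := by
  have ha_punctured : a ∈ punctured n := K.notMem_skeleton_zero_iff.1 fun h => x.2 ⟨_, h, ha⟩
  let G : I × I → K.M := fun p =>
    K.toM t ⟨contractedHalfEdge hn a i p.1 p.2,
      contractedHalfEdge_mem_punctured hn ha_punctured i _ _⟩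
  have continuous_G : Continuous G := (K.toM t).continuous.comp <| Continuous.subtype_mk
    (continuous_segment.comp (f := fun p : I × I => ((a, segmentPoint hn i p.2), p.1))
      ((continuous_const.prodMk ((continuous_segmentPoint hn i).comp continuous_snd)).prodMk
        continuous_fst)) _
  have G_zero (τ) : G (0, τ) = x :=
    Subtype.ext ((congrArg (K.proj ⟨t, ·⟩) (segment a (segmentPoint hn i τ)).source).trans ha)
  have mem_U := isCompact_univ.eventually_forall_of_forall_eventually (x₀ := (0 : I))
    (P := fun η τ => G (η, τ) ∈ U) fun τ _ =>
      continuous_G.continuousAt.eventually_mem ((G_zero τ).symm ▸ hU)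
  exact mem_U.mono fun η h τ => ⟨_, h τ trivial, rfl⟩

theorem exists_contractedGraph_subset {P : Set K.Points} (hP : P.Finite) {x : K.M}
    (hx : ∀ p ∈ P, K.proj p = x.1) {U : Set K.M} (hU : U ∈ 𝓝 x) :
    ∃ η : I, 0 < η.1 ∧ contractedGraph hn P η ⊆ Subtype.val '' U := by
  have eventually_mem : ∀ᶠ η in 𝓝 (0 : I), ∀ p ∈ P, ∀ i τ,
      K.proj ⟨p.1, contractedHalfEdge hn p.2 i η τ⟩ ∈ Subtype.val '' U :=
    (Filter.eventually_all_finite hP).2 fun p hp => Filter.eventually_all.2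
      (eventually_proj_contractedHalfEdge_mem hn (hx p hp) hU)
  have : (𝓝[>] (0 : I)).NeBot := nhdsGT_neBot_of_exists_gt ⟨1, one_pos⟩
  obtain ⟨η, hmem, hη⟩ := ((eventually_mem.filter_mono nhdsWithin_le_nhds).and
    (eventually_mem_nhdsWithin (s := Set.Ioi 0))).exists
  refine ⟨η, hη, ?_⟩
  rintro z ⟨p, hp, i, τ, rfl⟩
  exact hmem p hp i τ

end Triangulation

namespace Triangulation

open Simplex Module

variable {n : ℕ} {T : Type*} {K : Triangulation n T}

theorem DualPath.exists_foldl_eq {t t' : T} (δ : K.DualPath t t') :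
    ∃ l : List (Fin (n + 1)), l.foldl (fun t i => (K.partner (t, i)).1) t = t' := by
  induction δ with
  | nil t => exact ⟨[], rfl⟩
  | cons f _ ih =>
    obtain ⟨l, hl⟩ := ih
    exact ⟨f.2 :: l, hl⟩

variable (K) in
theorem countable_of_connectedSpace [ConnectedSpace K.Space] : Countable T := by
  cases isEmpty_or_nonempty T
  · infer_instance
  · obtain ⟨t⟩ := ‹Nonempty T›
    exact Function.Surjective.countable fun t' =>
      (nonempty_dualPath (K := K) t t').elim DualPath.exists_foldl_eq

section Chart

variable {F : Type*} [NormedAddCommGroup F] [NormedSpace ℝ F]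

/-- On each simplex, every value of the chart `e` is taken by one of the affine maps in `A`. -/
def IsAffineChart (A : Set ((Fin (n + 1) → ℝ) →ᵃ[ℝ] F)) (e : OpenPartialHomeomorph K.M F) : Prop :=
  ∀ y : K.Points, ∀ u ∈ e.source, u.1 = K.proj y → ∃ L ∈ A, e u = L y.2.1

theorem exists_countable_isAffineChart [Countable T] {e : OpenPartialHomeomorph K.M F}
    (he : ∀ (t : T) (a : Simplex n), (∃ u ∈ e.source, u.1 = K.proj ⟨t, a⟩) →
      ∃ W ∈ 𝓝 a, ∃ A : Set ((Fin (n + 1) → ℝ) →ᵃ[ℝ] F), A.Finite ∧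
        ∀ b ∈ W, ∀ u ∈ e.source, u.1 = K.proj ⟨t, b⟩ → ∃ L ∈ A, e u = L b.1) :
    ∃ A : Set ((Fin (n + 1) → ℝ) →ᵃ[ℝ] F), A.Countable ∧ IsAffineChart A e := by
  have local_pieces : ∀ y : K.Points, (∃ u ∈ e.source, u.1 = K.proj y) →
      ∃ W ∈ 𝓝 y, ∃ A : Set ((Fin (n + 1) → ℝ) →ᵃ[ℝ] F), A.Finite ∧
        ∀ z ∈ W, ∀ u ∈ e.source, u.1 = K.proj z → ∃ L ∈ A, e u = L z.2.1 := by
    rintro ⟨t, a⟩ ha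
    obtain ⟨W, hW, A, hA, hL⟩ := he t a ha
    refine ⟨Sigma.mk t '' W, IsOpenEmbedding.sigmaMk.image_mem_nhds.2 hW, A, hA, ?_⟩
    rintro _ ⟨b, hb, rfl⟩
    exact hL b hb
  choose! W hW A hA hL using local_pieces
  obtain ⟨C, hCs, hC, hcover⟩ := TopologicalSpace.countable_cover_nhdsWithin
    (s := {y : K.Points | ∃ u ∈ e.source, u.1 = K.proj y}) (f := W)
    fun y hy => mem_nhdsWithin_of_mem_nhds (hW y hy)
  refine ⟨⋃ y ∈ C, A y, hC.biUnion fun y hy => (hA y (hCs hy)).countable, fun z u hu huz => ?_⟩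
  obtain ⟨y, hy, hz⟩ := Set.mem_iUnion₂.1 (hcover ⟨u, hu, huz⟩)
  obtain ⟨L, hLA, hLe⟩ := hL y (hCs hy) z hz u hu huz
  exact ⟨L, Set.mem_iUnion₂.2 ⟨y, hy, hLA⟩, hLe⟩

theorem exists_mem_image_slice (hK : ∀ x : K.Flag, Even x.period) {e : OpenPartialHomeomorph K.M F}
    {A : Set ((Fin (n + 1) → ℝ) →ᵃ[ℝ] F)} (he : IsAffineChart A e) {z : F} (hz : z ∈ e.target)
    (ramified : ¬ K.IsUnramifiedAt (e.symm z).1) :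
    ∃ L ∈ A, ∃ i j k l : Fin (n + 1), i ≠ j ∧ k ≠ i ∧ k ≠ j ∧ k ≠ l ∧ z ∈ L '' slice i j k l := by
  obtain ⟨⟨t, a⟩, ha⟩ := Quot.exists_rep (e.symm z).1
  obtain ⟨L, hLA, hL⟩ := he ⟨t, a⟩ _ (e.map_target hz) ha.symm
  obtain ⟨i, j, k, l, hij, hki, hkj, hkl, hi, hj, hk⟩ :=
    exists_corners_of_not_isUnramifiedAt hK fun h => ramified (ha ▸ h)
  rw [e.right_inv hz] at hL
  exact ⟨L, hLA, i, j, k, l, hij, hki, hkj, hkl, a.1, ⟨a.2.2, hi, hj, hk⟩, hL.symm⟩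

/-- The ramified points lie in countably many pieces of codimension three, which miss the
contracted graph; so a generic point spans with it a cone that still misses them. -/
theorem exists_apex (hn : 3 ≤ n) [FiniteDimensional ℝ F] (hF : n ≤ finrank ℝ F)
    (hK : ∀ x : K.Flag, Even x.period) {e : OpenPartialHomeomorph K.M F}
    {A : Set ((Fin (n + 1) → ℝ) →ᵃ[ℝ] F)} (hA : A.Countable) (he : IsAffineChart A e)
    {P : Set K.Points} (hP : P.Countable) {η : unitInterval} (hη : 0 < η.1) {V : Set F}
    (hV : IsOpen V) (hV_nonempty : V.Nonempty) :
    ∃ c ∈ V, ∀ u ∈ e.source, u.1 ∈ contractedGraph hn P η → ∀ z ∈ segment ℝ c (e u),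
      z ∈ e.target → K.IsUnramifiedAt (e.symm z).1 := by
  have := hA.to_subtype
  have := hP.to_subtype
  let Corners := {q : Fin 4 → Fin (n + 1) // q 0 ≠ q 1 ∧ q 2 ≠ q 0 ∧ q 2 ≠ q 1 ∧ q 2 ≠ q 3}
  let S (m : (A × Corners) × A × P × Fin (n + 1)) : Set F :=
    m.1.1.1 '' slice (m.1.2.1 0) (m.1.2.1 1) (m.1.2.1 2) (m.1.2.1 3)
  let ℓ (m : (A × Corners) × A × P × Fin (n + 1)) : Set F :=
    m.2.1.1 '' Set.range fun τ => (contractedHalfEdge hn m.2.2.1.1.2 m.2.2.2 η τ).1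
  have codim (m) : finrank ℝ (vectorSpan ℝ (S m)) + finrank ℝ (vectorSpan ℝ (ℓ m)) + 1 <
      finrank ℝ F := by
    obtain ⟨⟨L, q, h₀₁, h₂₀, h₂₁, h₂₃⟩, L', p, i⟩ := m
    have hS := finrank_vectorSpan_image_le L.1 (slice (q 0) (q 1) (q 2) (q 3))
    have hslice := finrank_vectorSpan_slice_add_three_le hn h₀₁ h₂₀ h₂₁ h₂₃
    have hℓ := (finrank_vectorSpan_image_le L'.1 _).trans
      (collinear_contractedHalfEdge hn p.1.2 i η).finrank_le_one
    dsimp only [S, ℓ]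
    omega
  obtain ⟨c, hcV, hc⟩ := exists_mem_forall_segment_eq codim hV hV_nonempty
  refine ⟨c, hcV, fun u hu hgraph z hz hz_target => ?_⟩
  by_contra ramified
  obtain ⟨L, hLA, i, j, k, l, hij, hki, hkj, hkl, hzL⟩ :=
    exists_mem_image_slice hK he hz_target ramified
  obtain ⟨p, hp, i', τ, hu_eq⟩ := id hgraph
  obtain ⟨L', hLA', hL'⟩ := he _ u hu hu_eq
  have hzu : z = e u :=
    hc ((⟨L, hLA⟩, ⟨![i, j, k, l], hij, hki, hkj, hkl⟩), ⟨L', hLA'⟩, ⟨p, hp⟩, i')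
      z hzL (e u) ⟨_, ⟨τ, rfl⟩, hL'.symm⟩ hz
  refine ramified ?_
  rw [hzu, e.left_inv hu]
  exact isUnramifiedAt_of_mem_contractedGraph hn hη hgraph

theorem eq_of_simplyConnectedSpace {Y : Type*} [TopologicalSpace Y] [SimplyConnectedSpace Y]
    (j : C(Y, K.Space)) (hj : ∀ y, K.IsUnramifiedAt (j y)) {u v : K.unfolding.Space} (Γ : Path u v)
    (γ : C(unitInterval, Y)) (hγ : ∀ τ, K.fold (Γ τ) = j (γ τ)) (h : γ 0 = γ 1) : u = v :=
  let loop : Path (γ 0) (γ 0) := ⟨γ, rfl, h.symm⟩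
  (K.eq_of_homotopic_fold j hj (SimplyConnectedSpace.paths_homotopic loop (Path.refl _)) Γ
    (Path.refl u) hγ fun _ => Γ.source ▸ hγ 0).symm

theorem eq_of_joinedIn_of_cone {e : OpenPartialHomeomorph K.M F} {B : Set F} (hB : Convex ℝ B)
    (hBe : B ⊆ e.target) {c : F} (hc : c ∈ B) {G : Set K.Space}
    (hG : G ⊆ Subtype.val '' (e.source ∩ e ⁻¹' B))
    (hcone : ∀ u ∈ e.source, u.1 ∈ G → ∀ z ∈ segment ℝ c (e u), z ∈ e.target →
      K.IsUnramifiedAt (e.symm z).1) {x y : K.unfolding.Space}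
    (hxy : JoinedIn (K.fold ⁻¹' G) x y) (hfold : K.fold x = K.fold y) : x = y := by
  obtain ⟨Γ, hΓ⟩ := hxy
  let S : Set F := {z | z ∈ B ∧ ∀ z' ∈ segment ℝ c z, K.IsUnramifiedAt (e.symm z').1}
  have starConvex : StarConvex ℝ c S := by
    rw [starConvex_iff_segment_subset]
    rintro z ⟨hz, hz'⟩ z₁ hz₁
    exact ⟨hB.segment_subset hc hz hz₁, fun z₂ hz₂ =>
      hz' _ ((convex_segment c z).segment_subset (left_mem_segment ℝ c z) hz₁ hz₂)⟩
  choose m hm hm_eq using fun τ => hG (hΓ τ)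
  have m_mem (τ) : e (m τ) ∈ S := ⟨(hm τ).2, fun z hz =>
    hcone (m τ) (hm τ).1 (hm_eq τ ▸ hΓ τ) z hz (hBe (hB.segment_subset hc (hm τ).2 hz))⟩
  have continuous_m : Continuous m := continuous_induced_rng.2 <| by
    simpa only [Function.comp_def, hm_eq] using K.continuous_fold.comp Γ.continuous
  have := starConvex.contractibleSpace ⟨_, m_mem 0⟩
  refine eq_of_simplyConnectedSpace (Y := S)
    ⟨fun z => (e.symm z.1).1, continuous_subtype_val.comp
      (e.continuousOn_symm.comp_continuous continuous_subtype_val fun z => hBe z.2.1)⟩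
    (fun z => z.2.2 _ (right_mem_segment ℝ c z.1)) Γ
    ⟨fun τ => ⟨e (m τ), m_mem τ⟩, (e.continuousOn.comp_continuous continuous_m
      fun τ => (hm τ).1).subtype_mk _⟩ (fun τ => ?_) (Subtype.ext (congrArg e (Subtype.ext ?_)))
  · exact (hm_eq τ).symm.trans (congrArg Subtype.val (e.left_inv (hm τ).1).symm)
  · rw [hm_eq, hm_eq, Γ.source, Γ.target, hfold]

end Chart

theorem IsPLManifold.isUnramifiedAt (hn : 3 ≤ n) [Countable T] (hK : ∀ x : K.Flag, Even x.period)
    (hM : K.IsPLManifold) (x : K.M) : K.IsUnramifiedAt x.1 := by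
  obtain ⟨e, hx_source, pieces⟩ := hM x
  obtain ⟨A, hA, he⟩ := exists_countable_isAffineChart pieces
  obtain ⟨r, hr, ball_subset⟩ := Metric.isOpen_iff.1 e.open_target (e x) (e.map_source hx_source)
  have x_mem_ball := Metric.mem_ball_self (x := e x) hr
  obtain ⟨t, ⟨a, ha⟩, hta⟩ := K.exists_toM_eq x
  have hax : K.proj ⟨t, a⟩ = x.1 := congrArg Subtype.val hta
  rw [← hax]
  refine K.isUnramifiedAt_proj fun s s' hs => ?_
  obtain ⟨P, hP, proj_eq, joined⟩ := exists_finite_joinedIn_contractedGraph hn hs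
  obtain ⟨η, hη, graph_subset⟩ := exists_contractedGraph_subset hn hP
    (fun p hp => (proj_eq p hp).trans hax)
    ((e.isOpen_inter_preimage Metric.isOpen_ball).mem_nhds ⟨hx_source, x_mem_ball⟩)
  obtain ⟨c, hc, cone⟩ := exists_apex hn finrank_euclideanSpace_fin.ge hK hA he hP.countable hη
    Metric.isOpen_ball ⟨e x, x_mem_ball⟩
  have sheet_eq := eq_of_joinedIn_of_cone (convex_ball (e x) r) ball_subset hc graph_subset cone
    (joined η) rfl
  have start_mem : K.proj ⟨t, segment a (barycentre n) η⟩ ∈ contractedGraph hn P η :=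
    (joined η).source_mem
  exact isUnramifiedAt_of_mem_contractedGraph hn hη start_mem t _ s s' rfl sheet_eq

theorem exists_isCanonicalRep (hn : 3 ≤ n) (hK : ∀ x : K.M, K.IsUnramifiedAt x.1) (t₀ : T) :
    ∃ ρ : FundamentalGroup K.M (K.dualVertex hn t₀) →* Perm (Fin (n + 1)),
      K.IsCanonicalRep hn t₀ ρ := by
  have wellDefined : ∀ γ δ : K.DualPath t₀ t₀, Path.Homotopic.Quotient.mk (γ.toPath hn) =
      .mk (δ.toPath hn) → γ.projectivity = δ.projectivity := by
    intro γ δ h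
    obtain ⟨Γ, hΓ⟩ := DualPath.exists_lift hn γ 1
    obtain ⟨Δ, hΔ⟩ := DualPath.exists_lift hn δ 1
    have same_end := K.eq_of_homotopic_fold ⟨Subtype.val, continuous_subtype_val⟩ hK
      (Path.Homotopic.Quotient.eq.1 h) Γ Δ hΓ hΔ
    rw [mul_one, mul_one] at same_end
    exact hK (K.dualVertex hn t₀) t₀ _ _ _ rfl same_end
  choose δ hδ using fun a : FundamentalGroup K.M (K.dualVertex hn t₀) => exists_dualPath_eq hn a
  refine ⟨MonoidHom.mk' (fun a => (δ a).projectivity) fun a b => ?_, fun a s => ⟨?_, ?_⟩⟩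
  · rw [← DualPath.projectivity_append]
    refine wellDefined _ _ ?_
    rw [DualPath.mk_toPath_append, hδ, hδ, hδ]
    rfl
  · rintro rfl
    exact ⟨δ a, hδ a, rfl⟩
  · rintro ⟨γ, hγ, rfl⟩
    exact wellDefined _ _ ((hδ a).trans hγ.symm)

end Triangulation

/- `Nat.card` of an infinite set is `0`, so that a singlex of infinite degree counts as even, as it
should: no loop closes up around it. -/
theorem mainTheorem5_general {n : ℕ} (hn : 3 ≤ n) {T : Type*} (K : Triangulation n T)
    [ConnectedSpace K.Space] (t₀ : T) :
    ((∃ ρ : FundamentalGroup K.M (K.dualVertex hn t₀) →* Perm (Fin (n + 1)),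
        K.IsCanonicalRep hn t₀ ρ) → K.IsEven) ∧
    (n = 3 ∨ K.IsPLManifold → K.IsEven →
      ∃ ρ : FundamentalGroup K.M (K.dualVertex hn t₀) →* Perm (Fin (n + 1)),
        K.IsCanonicalRep hn t₀ ρ) := by
  refine ⟨fun ⟨ρ, hρ⟩ => hρ.isEven, fun h hK => ?_⟩
  have even_period := (Triangulation.isEven_iff_even_period (Nat.le_of_succ_le hn)).1 hK
  have := K.countable_of_connectedSpace
  refine Triangulation.exists_isCanonicalRep hn ?_ t₀
  rcases h with rfl | hM
  · exact Triangulation.isUnramifiedAt_of_eq_three even_period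
  · exact hM.isUnramifiedAt hn even_period

theorem mainTheorem5 {n : ℕ} (hn : 3 ≤ n) {T : Type*} [Finite T] (K : Triangulation n T)
    [ConnectedSpace K.Space] (t₀ : T) :
    ((∃ ρ : FundamentalGroup K.M (K.dualVertex hn t₀) →* Equiv.Perm (Fin (n + 1)),
        K.IsCanonicalRep hn t₀ ρ) → K.IsEven) ∧
    (n = 3 ∨ K.IsPLManifold → K.IsEven →
      ∃ ρ : FundamentalGroup K.M (K.dualVertex hn t₀) →* Equiv.Perm (Fin (n + 1)),
        K.IsCanonicalRep hn t₀ ρ) :=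
  mainTheorem5_general hn K t₀
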